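/- Let $m \ge 3$ and let $\Delta$ be a thick compact $m$-gon. That is, $\Delta$ is a thick spherical building of rank $2$ and diameter $m$ (equivalently, a generalized $m$-gon: a connected bipartite graph of diameter $m$ and girth $2m$, in which every vertex has at least three neighbours), its vertex set $\mathrm{Vert}\,\Delta$ carries a compact metrizable topology, and the set $\mathrm{Ch}\,\Delta$ of chambers (edges, viewed as pairs of vertices ordered by type) is closed in $(\mathrm{Vert}\,\Delta)^2$ and is given the induced topology. For a vertex $v$ let $\mathrm{Ch}(v)$ be the set of chambers containing $v$. Two chambers are opposite if their gallery distance is $m$; apartments are the cycles of length $2m$ in $\Delta$. Let $\mathrm{Aut}_{\mathrm{top}}(\Delta)$ be the group of all automorphisms of the simplicial complex $\Delta$ which act by homeomorphisms on $\mathrm{Vert}\,\Delta$ and on $\mathrm{Ch}\,\Delta$, with the topology induced from the compact-open topology on the set of continuous maps $\mathrm{Ch}\,\Delta \to \mathrm{Ch}\,\Delta$. Let $\rho$ be any metric on $\mathrm{Ch}\,\Delta$ inducing its topology, and write $B_v(X,r)=\{Y \in \mathrm{Ch}(v) : \rho(X,Y)<r\}$ for $X\in \mathrm{Ch}(v)$.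 Let $C, C'$ be opposite chambers of $\Delta$. Let $D_0 \ne D_1$ be the two chambers adjacent to (and different from) $C$ in the apartment containing $C$ and $C'$, and let $v_i$ be the common vertex of $C$ and $D_i$ ($i=0,1$). Let $E_i$ be a chamber with vertex $v_i$, different from $C$ and $D_i$ ($i=0,1$). Let $U$ and $U'$ be closed subsets of $\mathrm{Ch}\,\Delta$ such that every chamber of $U$ is opposite every chamber of $U'$. Then for every $\varepsilon>0$ the (possibly empty) set $J_\varepsilon$ of all $\varphi \in \mathrm{Aut}_{\mathrm{top}}(\Delta)$ such that - $\varphi(C)\in U$ and $\varphi(C')\in U'$, - $\rho(\varphi(C),\varphi(X)) \ge \varepsilon$ for all $X \in B_{v_i}(D_i,\varepsilon)$ and $i\in\{0,1\}$, - $\rho(\varphi(D_i),\varphi(X)) \ge \varepsilon$ for all $X \in B_{v_i}(C,\varepsilon)$ and $i\in\{0,1\}$, - $\rho(\varphi(C),\varphi(E_i)) \ge \varepsilon$ for $i\in\{0,1\}$, - $\rho(\varphi(D_i),\varphi(E_i)) \ge \varepsilon$ for $i\in\{0,1\}$, is compact in $\mathrm{Aut}_{\mathrm{top}}(\Delta)$.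 -/

import Mathlib

/-- An `m`-gon: a spherical building of rank `2` and diameter `m`, given as its `1`-dimensional
simplicial complex, i.e. as a generalized `m`-gon: a connected bipartite graph of diameter `m` and
girth `2 * m`. The two types of vertices come with a fixed ordering (`false` first, `true`
second). -/
structure MGon (V : Type*) (m : ℕ) where
  /-- The graph whose vertices and edges are the vertices and chambers of the building. -/
  graph : SimpleGraph V
  /-- The type function on vertices; adjacent vertices have different types. -/
  type : graph.Coloring Bool
  connected : graph.Connected
  ediam_eq : graph.ediam = m
  egirth_eq : graph.egirth = (2 * m : ℕ)

namespace MGon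

variable {V : Type*} {m : ℕ} (Δ : MGon V m)

/-- The set of chambers, inside `V × V`: the pairs of adjacent vertices, ordered by type. -/
def chamberSet : Set (V × V) :=
  {p | Δ.graph.Adj p.1 p.2 ∧ Δ.type p.1 = false}

/-- The chambers of `Δ`. When `V` is a topological space, this carries the topology induced from
the product topology on `V × V`. -/
abbrev Chamber : Type _ := Δ.chamberSet

/-- `v` is one of the two vertices of the chamber `C`. -/
def IsVertex (v : V) (C : Δ.Chamber) : Prop := v = C.1.1 ∨ v = C.1.2

/-- The chamber with vertices `a` and `b`. -/
def chamberOf (a b : V) (h : Δ.graph.Adj a b) : Δ.Chamber :=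
  if ha : Δ.type a = false then ⟨(a, b), h, ha⟩
  else ⟨(b, a), h.symm, by
    have := Δ.type.valid h
    revert ha this
    cases Δ.type a <;> cases Δ.type b <;> simp⟩

/-- Every panel (i.e. vertex) is contained in at least three chambers. -/
def IsThick : Prop := ∀ v : V, 3 ≤ (Δ.graph.neighborSet v).encard

/-- The graph of chambers: two distinct chambers are adjacent if they share a vertex. -/
def chamberGraph : SimpleGraph Δ.Chamber where
  Adj C D := C ≠ D ∧ ∃ v, Δ.IsVertex v C ∧ Δ.IsVertex v D
  symm := ⟨fun _ _ h => ⟨h.1.symm, h.2.imp fun _ hv => hv.symm⟩⟩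
  loopless := ⟨fun _ h => h.1 rfl⟩

/-- Two chambers of an `m`-gon are opposite if their gallery distance is `m`. -/
def Opposite (C D : Δ.Chamber) : Prop := Δ.chamberGraph.dist C D = m

/-- The apartments of an `m`-gon are its subgraphs that are cycles of length `2 * m`. -/
def IsApartment (A : Δ.graph.Subgraph) : Prop :=
  Nonempty (A.coe ≃g SimpleGraph.cycleGraph (2 * m))

/-- The chamber `C` belongs to the subcomplex `A`. -/
def ChamberIn (C : Δ.Chamber) (A : Δ.graph.Subgraph) : Prop := A.Adj C.1.1 C.1.2

/-- The action on chambers of an automorphism of the simplicial complex `Δ`. The automorphism is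
not required to preserve types. -/
def chamberMap (φ : Δ.graph ≃g Δ.graph) (C : Δ.Chamber) : Δ.Chamber :=
  Δ.chamberOf (φ C.1.1) (φ C.1.2) (φ.map_adj_iff.2 C.2.1)

theorem chamberOf_of_false {a b : V} (h : Δ.graph.Adj a b) (ha : Δ.type a = false) :
    Δ.chamberOf a b h = ⟨(a, b), h, ha⟩ := dif_pos ha

theorem chamberOf_comm {a b : V} (h : Δ.graph.Adj a b) :
    Δ.chamberOf a b h = Δ.chamberOf b a h.symm := by
  have hv := Δ.type.valid h
  unfold chamberOf
  by_cases ha : Δ.type a = false <;> by_cases hb : Δ.type b = false <;> simp_all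

theorem chamberMap_chamberOf (φ : Δ.graph ≃g Δ.graph) {a b : V} (h : Δ.graph.Adj a b) :
    Δ.chamberMap φ (Δ.chamberOf a b h) = Δ.chamberOf (φ a) (φ b) (φ.map_adj_iff.2 h) := by
  by_cases ha : Δ.type a = false
  · rw [Δ.chamberOf_of_false h ha]
    rfl
  · have hb : Δ.type b = false := by
      have hv := Δ.type.valid h
      simp_all
    rw [Δ.chamberOf_comm h, Δ.chamberOf_of_false h.symm hb, Δ.chamberOf_comm (φ.map_adj_iff.2 h)]
    rfl

theorem chamberMap_one : Δ.chamberMap 1 = id := by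
  funext C
  exact Δ.chamberOf_of_false C.2.1 C.2.2

theorem chamberMap_mul (φ ψ : Δ.graph ≃g Δ.graph) :
    Δ.chamberMap (φ * ψ) = Δ.chamberMap φ ∘ Δ.chamberMap ψ := by
  funext C
  exact (Δ.chamberMap_chamberOf φ (ψ.map_adj_iff.2 C.2.1)).symm

variable [TopologicalSpace V]

/-- A compact `m`-gon: the vertex set carries a compact metrizable topology in which the set of
chambers is closed in `V × V`. -/
structure IsCompactPolygon : Prop where
  compact : CompactSpace V
  metrizable : TopologicalSpace.MetrizableSpace V
  isClosed_chamberSet : IsClosed Δ.chamberSet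

theorem isHomeomorph_of_inverse {X : Type*} [TopologicalSpace X] {f g : X → X}
    (hf : IsHomeomorph f) (hg : f ∘ g = id) : IsHomeomorph g := by
  have e : g = hf.homeomorph.symm := by
    funext x
    apply hf.injective
    rw [show f (g x) = x from congrFun hg x]
    exact (hf.homeomorph.apply_symm_apply x).symm
  rw [e]
  exact hf.homeomorph.symm.isHomeomorph

/-- The group of topological automorphisms: the automorphisms of `Δ` whose actions on vertices and
on chambers are homeomorphisms. -/
def topAut : Subgroup (Δ.graph ≃g Δ.graph) where
  carrier := {φ | IsHomeomorph (φ : V → V) ∧ IsHomeomorph (Δ.chamberMap φ)}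
  one_mem' := by
    refine ⟨IsHomeomorph.id, ?_⟩
    rw [chamberMap_one]
    exact IsHomeomorph.id
  mul_mem' := by
    intro φ ψ hφ hψ
    refine ⟨hφ.1.comp hψ.1, ?_⟩
    rw [chamberMap_mul]
    exact hφ.2.comp hψ.2
  inv_mem' := by
    intro φ hφ
    refine ⟨isHomeomorph_of_inverse hφ.1 ?_, isHomeomorph_of_inverse hφ.2 ?_⟩
    · funext x
      exact φ.apply_symm_apply x
    · rw [← chamberMap_mul, mul_inv_cancel, chamberMap_one]

/-- The continuous self-map of the space of chambers given by a topological automorphism. -/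
def toContinuousMap (φ : Δ.topAut) : C(Δ.Chamber, Δ.Chamber) :=
  ⟨Δ.chamberMap φ.1, φ.2.2.continuous⟩

/-- The topology on the group of topological automorphisms induced from the compact-open topology
on the continuous self-maps of the space of chambers. -/
instance : TopologicalSpace Δ.topAut :=
  TopologicalSpace.induced Δ.toContinuousMap ContinuousMap.compactOpen

end MGon

/-- `ρ` is a metric on `X` that induces the topology of `X`. -/
def IsCompatibleMetric {X : Type*} [t : TopologicalSpace X] (ρ : X → X → ℝ) : Prop :=
  ∃ d : MetricSpace X,
    d.toPseudoMetricSpace.toUniformSpace.toTopologicalSpace = t ∧ ∀ x y, ρ x y = d.dist x y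

/-- The open ball in `Cham(v)`, the set of chambers with vertex `v`, of radius `r` around `C`. -/
def MGon.panelBall {V : Type*} {m : ℕ} (Δ : MGon V m) (ρ : Δ.Chamber → Δ.Chamber → ℝ)
    (v : V) (C : Δ.Chamber) (r : ℝ) : Set Δ.Chamber :=
  {X | Δ.IsVertex v X ∧ ρ X C < r}

/-! Compactness is tested on an ultrafilter `F` containing the set: `F` must converge to one of its
members. The ultrapower of the polygon along `F` is again a thick polygon, and it maps onto the
original one in two ways: σ sends a family of vertices `x φ` to its limit, and ψ sends it to the
limit of `φ (x φ)`. If ψ factors as `τ ∘ σ`, then `φ` converges continuously to `τ` along `F`. The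
core is therefore a topology-free comparison of two surjective homomorphisms of thick polygons.

The comparison is local. Perspectivities between vertices that are opposite in the ultrapower and
under both maps respect the fibres of σ and ψ on panels, so properties of these fibres travel
(`Inv.move`, `trans_even`). The metric conditions put the panels of the two vertices of `C` in
general position: no neighbour is glued to one chosen point by σ and to the other by ψ
(`germPair_regular`). `Frame.good` and `Good.all` spread this to all panels. Then the σ-fibre and
the ψ-fibre of a point in its panel are nested, in the same direction throughout one type;
`refines_of_even` transfers the direction to the other type, and `eq_of_refines` passes from panels
to the whole polygon. Hence one of σ and ψ factors through the other (`comparable`). In the unwanted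
case the inverse automorphisms converge instead, which is enough (`exists_convergesTo`).

It remains to see that the continuous surjective endomorphism `τ` is injective
(`IsCompactPolygon.injective`). A collapse would make it locally constant on every panel; compact
panels would then have finite images, the polygon would be finite, and a surjective self-map would
be injective after all. The limit lies in the set because every condition is closed. -/

/-! ### Thick polygons and their homomorphisms -/

/-- A thick generalized `m`-gon, given by the distance function of its incidence graph. -/
structure ThickPolygon (W : Type*) (m : ℕ) where
  /-- The distance function. Two vertices are adjacent if their distance is `1`. -/
  d : W → W → ℕ
  d_le : ∀ x y, d x y ≤ m
  comm : ∀ x y, d x y = d y x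
  eq_of_d : ∀ x y, d x y = 0 → x = y
  d_self : ∀ x, d x x = 0
  step : ∀ x y z, d y z = 1 → d x z = d x y + 1 ∨ d x y = d x z + 1
  desc : ∀ x y k, d x y = k + 1 → ∃ z, d y z = 1 ∧ d x z = k
  uniq : ∀ x y z z' k, d x y = k + 1 → k + 1 < m → d y z = 1 → d y z' = 1 →
    d x z = k → d x z' = k → z = z'
  thick : ∀ y a b, ∃ z, d y z = 1 ∧ z ≠ a ∧ z ≠ b

namespace ThickPolygon

variable {W W' : Type*} {n : ℕ} (P : ThickPolygon W (n + 3)) (P' : ThickPolygon W' (n + 3))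

/-- Below the maximal distance at most one neighbour leads back to `x`, and thickness supplies a
second one. -/
theorem exists_opp (x : W) : ∃ w, P.d x w = n + 3 := by
  have h : ∀ k, k ≤ n + 3 → ∃ w, P.d x w = k := by
    intro k
    induction k with
    | zero => exact fun _ => ⟨x, P.d_self x⟩
    | succ k ih =>
      intro hk
      obtain ⟨w, hw⟩ := ih (by omega)
      obtain ⟨z, z', hz, hz', hne⟩ : ∃ z z', P.d w z = 1 ∧ P.d w z' = 1 ∧ z ≠ z' := by
        obtain ⟨z, hz, -⟩ := P.thick w w w
        obtain ⟨z', hz', h', -⟩ := P.thick w z w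
        exact ⟨z, z', hz, hz', h'.symm⟩
      rcases P.step x w z hz with h | h
      · exact ⟨z, by omega⟩
      rcases P.step x w z' hz' with h' | h'
      · exact ⟨z', by omega⟩
      exact absurd (P.uniq x w z z' (P.d x z) (by omega) (by omega) hz hz' rfl (by omega)) hne
  exact h _ le_rfl

/-- Every vertex is joined to any other by a path, in the form of an induction principle. -/
theorem induction_adj {p : W → Prop} (o : W) (ho : p o)
    (hs : ∀ v u, P.d v u = 1 → p v → p u) (v : W) : p v := by
  have h : ∀ k v, P.d o v = k → p v := by
    intro k
    induction k with
    | zero => intro v hv; rwa [← P.eq_of_d _ _ hv]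
    | succ k ih =>
      intro v hv
      obtain ⟨z, hz, hk⟩ := P.desc o v k hv
      exact hs z v (by rw [P.comm]; exact hz) (ih z hk)
  exact h _ v rfl

/-- A homomorphism of the incidence graphs. -/
def IsHom (f : W → W') : Prop := ∀ x y, P.d x y = 1 → P'.d (f x) (f y) = 1

variable {P P'}

/-- A geodesic is mapped to a walk, and `step` makes both graphs bipartite, so distances can only
drop, and by an even amount. -/
theorem IsHom.d_le {f : W → W'} (hf : P.IsHom P' f) (x y : W) :
    ∃ j, P.d x y = P'.d (f x) (f y) + 2 * j := by
  have h : ∀ k y, P.d x y = k → ∃ j, P.d x y = P'.d (f x) (f y) + 2 * j := by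
    intro k
    induction k with
    | zero =>
      intro y hy
      rw [← P.eq_of_d _ _ hy]
      exact ⟨0, by simp [P.d_self, P'.d_self]⟩
    | succ k ih =>
      intro y hy
      obtain ⟨z, hz, hk⟩ := P.desc x y k hy
      obtain ⟨j, hj⟩ := ih z hk
      rcases P'.step (f x) (f y) (f z) (hf _ _ hz) with h | h
      · exact ⟨j + 1, by omega⟩
      · exact ⟨j, by omega⟩
  exact h _ y rfl

/-- Choose `t` at distance `n + 2` from `f x` with `b` on the geodesic, and lift it to `y1`. An even
drop would exceed the diameter, so `y1` is at distance `n + 2` from `x` as well, and the neighbour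
of `x` facing `y1` must map to `b`. -/
theorem IsHom.exists_lift {f : W → W'} (hf : P.IsHom P' f) (hs : Function.Surjective f)
    {x : W} {b : W'} (hb : P'.d (f x) b = 1) : ∃ y, P.d x y = 1 ∧ f y = b := by
  obtain ⟨u', hu'1, hu'⟩ : ∃ u', P'.d b u' = n + 2 ∧ P'.d (f x) u' = n + 3 := by
    obtain ⟨u, hu⟩ := P'.exists_opp b
    have h1 := P'.step u b (f x) (by rw [P'.comm]; exact hb)
    have h2 := P'.d_le u (f x)
    rw [P'.comm u b] at h1
    obtain ⟨z, z', hz, hz', hne⟩ : ∃ z z', P'.d u z = 1 ∧ P'.d u z' = 1 ∧ z ≠ z' := by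
      obtain ⟨z, hz, -⟩ := P'.thick u u u
      obtain ⟨z', hz', h', -⟩ := P'.thick u z u
      exact ⟨z, z', hz, hz', h'.symm⟩
    have a1 := P'.step b u z hz
    have a2 := P'.step b u z' hz'
    have b1 := P'.step (f x) u z hz
    have b2 := P'.step (f x) u z' hz'
    have c1 := P'.d_le b z
    have c2 := P'.d_le b z'
    have c0 := P'.comm u (f x)
    by_cases e1 : P'.d (f x) z = n + 3
    · exact ⟨z, by omega, e1⟩
    by_cases e2 : P'.d (f x) z' = n + 3
    · exact ⟨z', by omega, e2⟩
    exact absurd (P'.uniq (f x) u z z' (n + 1) (by omega) (by omega) hz hz'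
      (by omega) (by omega)) hne
  obtain ⟨y0, rfl⟩ := hs u'
  obtain ⟨t, ht1, ht⟩ : ∃ t, P'.d (f y0) t = 1 ∧ P'.d b t = n + 1 :=
    P'.desc _ _ _ hu'1
  have ht' : P'.d (f x) t = n + 2 := by
    have h1 := P'.step (f x) _ _ ht1
    have h2 := P'.d_le (f x) t
    omega
  obtain ⟨y1, rfl⟩ := hs t
  have hxy : P.d x y1 = n + 2 := by
    obtain ⟨j, hj⟩ := hf.d_le x y1
    have := P.d_le x y1
    omega
  obtain ⟨y, hy1, hy⟩ := P.desc y1 x (n + 1) (by rw [P.comm]; exact hxy)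
  refine ⟨y, hy1, ?_⟩
  have hy2 := hf _ _ hy1
  refine P'.uniq (f y1) (f x) _ _ (n + 1) (by rw [P'.comm]; omega) (by omega) hy2 hb ?_
    (by rw [P'.comm]; omega)
  obtain ⟨j, hj⟩ := hf.d_le y1 y
  have := P'.step (f y1) (f x) (f y) hy2
  have := P'.comm (f y1) (f x)
  omega

/-- Perspectivities between opposite vertices are compatible with homomorphisms. -/
theorem IsHom.eq_of_eq_persp {f : W → W'} (hf : P.IsHom P' f) {x w w' a b a' b' : W}
    (hw : f w = f w')
    (h : P'.d (f x) (f w) = n + 3) (ha : P.d x a = 1) (ha' : P.d w a' = 1)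
    (hb' : P.d w' b' = 1) (haa : P.d a a' = n + 1) (hbb : P.d b b' = n + 1) (e : f a = f b) :
    f a' = f b' := by
  have h1 := hf _ _ ha
  have h2 := hf _ _ ha'
  have h3 := hf _ _ hb'
  obtain ⟨j, hj⟩ := hf.d_le a a'
  obtain ⟨l, hl⟩ := hf.d_le b b'
  have h4 := P'.step (f w) (f x) (f a) h1
  have h5 := P'.d_le (f w) (f a)
  have h6 := P'.comm (f w) (f x)
  have h7 := P'.comm (f w) (f a)
  have h8 := P'.step (f a) (f w) (f a') h2
  rw [← e] at hl
  rw [← hw] at h3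
  have h9 := P'.step (f a) (f w) (f b') h3
  exact P'.uniq (f a) (f w) _ _ (n + 1) (by omega) (by omega) h2 h3 (by omega) (by omega)

end ThickPolygon

open ThickPolygon

/-! ### Pairs of homomorphisms and perspectivities -/

/-- Two surjective homomorphisms between thick polygons. -/
structure HomPair {W W' : Type*} {n : ℕ} (P : ThickPolygon W (n + 3))
    (P' : ThickPolygon W' (n + 3)) where
  /-- The first homomorphism. -/
  σ : W → W'
  /-- The second homomorphism. -/
  ψ : W → W'
  homσ : P.IsHom P' σ
  homψ : P.IsHom P' ψ
  surjσ : Function.Surjective σ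
  surjψ : Function.Surjective ψ

namespace HomPair

variable {W W' : Type*} {n : ℕ} {P : ThickPolygon W (n + 3)} {P' : ThickPolygon W' (n + 3)}
  (T : HomPair P P')

/-- The pair with the two homomorphisms exchanged. -/
def swap : HomPair P P' := ⟨T.ψ, T.σ, T.homψ, T.homσ, T.surjψ, T.surjσ⟩

/-- Both homomorphisms preserve the distance `k` of `x` and `y`. -/
def N (x y : W) (k : ℕ) : Prop :=
  P.d x y = k ∧ P'.d (T.σ x) (T.σ y) = k ∧ P'.d (T.ψ x) (T.ψ y) = k

/-- Both homomorphisms separate `x` and `y`. -/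
def Apart (x y : W) : Prop := T.σ x ≠ T.σ y ∧ T.ψ x ≠ T.ψ y

variable {T} {x y z w v a b a' b' s t : W} {k : ℕ}

theorem Apart.symm (h : T.Apart x y) : T.Apart y x := ⟨h.1.symm, h.2.symm⟩

theorem N.symm (h : T.N x y k) : T.N y x k := by
  obtain ⟨h1, h2, h3⟩ := h
  exact ⟨by rw [P.comm]; exact h1, by rw [P'.comm]; exact h2, by rw [P'.comm]; exact h3⟩

theorem N.swap (h : T.N x y k) : T.swap.N x y k := ⟨h.1, h.2.2, h.2.1⟩

/-- The diameter `n + 3` leaves no room above `n + 2` for an even drop of the distance. -/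
theorem N_of_eq (h1 : P'.d (T.σ x) (T.σ y) = k) (h2 : P'.d (T.ψ x) (T.ψ y) = k)
    (hk : n + 2 ≤ k) : T.N x y k := by
  obtain ⟨j, hj⟩ := T.homσ.d_le x y
  have := P.d_le x y
  exact ⟨by omega, h1, h2⟩

theorem N_of_ge (h1 : n + 2 ≤ P'.d (T.σ x) (T.σ y)) (h2 : n + 2 ≤ P'.d (T.ψ x) (T.ψ y))
    (hk : P.d x y = k) : T.N x y k := by
  obtain ⟨j, hj⟩ := T.homσ.d_le x y
  obtain ⟨l, hl⟩ := T.homψ.d_le x y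
  have := P.d_le x y
  exact ⟨by omega, by omega, by omega⟩

/-- The image distances change by one at each step and never exceed the distance upstairs, so they
descend along with it. -/
theorem N.down (h : T.N x y (k + 1)) (hz : P.d y z = 1) (hk : P.d x z ≤ k) : T.N x z k := by
  obtain ⟨h1, h2, h3⟩ := h
  obtain ⟨j, hj⟩ := T.homσ.d_le x z
  obtain ⟨l, hl⟩ := T.homψ.d_le x z
  have := P.step x y z hz
  have := P'.step (T.σ x) _ _ (T.homσ _ _ hz)
  have := P'.step (T.ψ x) _ _ (T.homψ _ _ hz)
  exact ⟨by omega, by omega, by omega⟩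

theorem N.desc (h : T.N x y (k + 1)) : ∃ z, P.d y z = 1 ∧ T.N x z k := by
  obtain ⟨z, hz, hk⟩ := P.desc _ _ _ h.1
  exact ⟨z, hz, h.down hz hk.le⟩

theorem N.opp (h : T.N x y (n + 3)) (hz : P.d y z = 1) : T.N x z (n + 2) := by
  refine h.down hz ?_
  have := P.step x y z hz
  have := P.d_le x z
  have := h.1
  omega

/-- In each image only one neighbour of `y` faces `x`, namely the image of `z`, and `w` is not sent
to it. -/
theorem N.up (h : T.N x y (k + 1)) (hk : k < n + 2) (hz : P.d y z = 1) (hxz : P.d x z = k)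
    (hw : P.d y w = 1) (hzw : T.Apart z w) : T.N x w (k + 2) := by
  have hN := h.down hz hxz.le
  obtain ⟨h1, h2, h3⟩ := h
  obtain ⟨g1, g2, g3⟩ := hN
  have e1 := P'.step (T.σ x) _ _ (T.homσ _ _ hw)
  have e2 := P'.step (T.ψ x) _ _ (T.homψ _ _ hw)
  have e3 := P.step x _ _ hw
  have f1 : P'.d (T.σ x) (T.σ w) ≠ k := fun e => hzw.1 <|
    P'.uniq _ _ _ _ k h2 (by omega) (T.homσ _ _ hz) (T.homσ _ _ hw) g2 e
  have f2 : P'.d (T.ψ x) (T.ψ w) ≠ k := fun e => hzw.2 <|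
    P'.uniq _ _ _ _ k h3 (by omega) (T.homψ _ _ hz) (T.homψ _ _ hw) g3 e
  obtain ⟨j, hj⟩ := T.homσ.d_le x w
  exact ⟨by omega, by omega, by omega⟩

theorem N.persp_σ (h : T.N x w (n + 3)) (ha : P.d x a = 1) (hb : P.d x b = 1) (ha' : P.d w a' = 1)
    (hb' : P.d w b' = 1) (haa : P.d a a' = n + 1) (hbb : P.d b b' = n + 1) :
    T.σ a = T.σ b ↔ T.σ a' = T.σ b' :=
  ⟨T.homσ.eq_of_eq_persp rfl h.2.1 ha ha' hb' haa hbb,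
    T.homσ.eq_of_eq_persp rfl h.symm.2.1 ha' ha hb (by rw [P.comm]; exact haa)
      (by rw [P.comm]; exact hbb)⟩

theorem N.persp_ψ (h : T.N x w (n + 3)) (ha : P.d x a = 1) (hb : P.d x b = 1) (ha' : P.d w a' = 1)
    (hb' : P.d w b' = 1) (haa : P.d a a' = n + 1) (hbb : P.d b b' = n + 1) :
    T.ψ a = T.ψ b ↔ T.ψ a' = T.ψ b' :=
  h.swap.persp_σ ha hb ha' hb' haa hbb

theorem N.persp_apart (h : T.N x w (n + 3)) (ha : P.d x a = 1) (hb : P.d x b = 1)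
    (ha' : P.d w a' = 1) (hb' : P.d w b' = 1) (haa : P.d a a' = n + 1) (hbb : P.d b b' = n + 1) :
    T.Apart a b ↔ T.Apart a' b' := by
  unfold Apart
  rw [Ne, Ne, h.persp_σ ha hb ha' hb' haa hbb, h.persp_ψ ha hb ha' hb' haa hbb]

theorem N.persp (h : T.N x w (n + 3)) (ha : P.d x a = 1) : ∃ a', P.d w a' = 1 ∧ T.N a a' (n + 1) :=
  (h.symm.opp ha).symm.desc

/-- Apartness of `s` and `t` is carried to the panel of `w`: `a` is apart from the projection of
`s`, hence leads away from `s`. -/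
theorem N.opp_nbr (h : T.N v w (n + 3)) (hs : P.d v s = 1) (ht : P.d v t = 1) (hst : T.Apart s t)
    (hw : P.d w a = 1) (hta : P.d t a = n + 1) : T.N s a (n + 3) := by
  obtain ⟨b, hb, hsb⟩ := h.persp hs
  exact (h.symm.opp hs).symm.up (by omega) hb hsb.1 hw
    ((h.persp_apart hs ht hb hw hsb.1 hta).1 hst)

variable (T)

/-- A predicate on pairs of neighbours of a vertex which is invariant under perspectivities that
are compatible with both homomorphisms. -/
def Inv (F : W → W → W → Prop) : Prop :=
  ∀ x w a b a' b', T.N x w (n + 3) → P.d x a = 1 → P.d x b = 1 → P.d w a' = 1 → P.d w b' = 1 →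
    P.d a a' = n + 1 → P.d b b' = n + 1 → F x a b → F w a' b'

/-- The existence of a third neighbour of `b`, in general position. -/
def HasThird (x b : W) : Prop :=
  ∃ y w, P.d b y = 1 ∧ T.Apart x y ∧ T.N x w (n + 3) ∧ T.N y w (n + 3)

variable {T}

/-- The pair is carried around a closed chain of perspectivities `x`, `w`, `y`, `w'`, `x`. It brings
`b`, a common neighbour of `x` and `y`, back to itself, while a suitable choice of `w'` brings `a`
to `c`. -/
theorem Inv.move {F : W → W → W → Prop} (hF : T.Inv F) {x b a c : W} (hQ : T.HasThird x b)
    (hb : P.d x b = 1) (ha : P.d x a = 1) (hc : P.d x c = 1) (hab : T.Apart a b)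
    (hcb : T.Apart c b) (h : F x a b) : F x c b := by
  obtain ⟨y, w, hby, hxy, hxw, hyw⟩ := hQ
  have hbx : P.d b x = 1 := by rw [P.comm]; exact hb
  have hyb : P.d y b = 1 := by rw [P.comm]; exact hby
  have hbw : T.N b w (n + 2) := (hxw.symm.opp hb).symm
  obtain ⟨a1, ha1, haa⟩ := hxw.persp ha
  obtain ⟨b1, hb1, hbb⟩ := hxw.persp hb
  have F1 : F w a1 b1 := hF x w a b a1 b1 hxw ha hb ha1 hb1 haa.1 hbb.1 h
  obtain ⟨c', hc', hac⟩ := hyw.symm.persp ha1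
  have F2 : F y c' b := hF w y a1 b1 c' b hyw.symm ha1 hb1 hc' hyb hac.1 hbb.symm.1 F1
  have hcb' : T.Apart c' b :=
    (hyw.symm.persp_apart ha1 hb1 hc' hyb hac.1 hbb.symm.1).1
      ((hxw.persp_apart ha hb ha1 hb1 haa.1 hbb.1).1 hab)
  -- `g` is the neighbour of `a1` facing `c'` (or `c'` itself) and is opposite `x`. Its neighbour
  -- `r` facing `c` is at distance `n + 1` from both `c` and `c'`, so any neighbour `w'` of `r`
  -- opposite `x` and `y` takes `c'` through `r` to `c`.
  obtain ⟨g, hg, hcg⟩ := hac.symm.desc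
  have hc'y : P.d c' y = 1 := by rw [P.comm]; exact hc'
  have hyg : T.N y g (n + 1) := by
    refine (hyw.opp ha1).down hg ?_
    have := P.step g c' y hc'y
    have := P.comm g c'
    have := P.comm g y
    have := hcg.1
    omega
  have hgb : T.N g b (n + 2) := hyg.symm.up (by omega) hc' hcg.symm.1 hyb hcb'
  have hgx : T.N g x (n + 3) := hgb.up (by omega) hby hyg.symm.1 hbx hxy.symm
  obtain ⟨r, hr, hcr⟩ := hgx.symm.persp hc
  obtain ⟨g', hg', hbg'⟩ := hgx.symm.persp hb
  have hrg : T.Apart r g' := (hgx.symm.persp_apart hc hb hr hg' hcr.1 hbg'.1).1 hcb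
  have hbr : T.N b r (n + 3) := hgb.symm.up (by omega) hg' hbg'.1 hr hrg.symm
  have hyr : T.N y r (n + 2) := (hbr.symm.opp hby).symm
  have hc'r : T.N c' r (n + 1) := by
    refine (hyr.symm.down hc' ?_).symm
    have := P.step c' g r hr
    have := P.comm r c'
    have := hcg.1
    omega
  -- `u` faces `w`, whereas `x` and `y` are opposite `w`, so `u` is apart from both; its projection
  -- to `r` is the required `w'`.
  obtain ⟨u, hu, hwu⟩ := hbw.symm.desc
  obtain ⟨w', hw', huw⟩ := hbr.persp hu
  have hxu : T.Apart x u := by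
    constructor
    · intro e
      have h1 := hxw.2.1
      have h2 := hwu.symm.2.1
      rw [e] at h1; omega
    · intro e
      have h1 := hxw.2.2
      have h2 := hwu.symm.2.2
      rw [e] at h1; omega
  have hyu : T.Apart y u := by
    constructor
    · intro e
      have h1 := hyw.2.1
      have h2 := hwu.symm.2.1
      rw [e] at h1; omega
    · intro e
      have h1 := hyw.2.2
      have h2 := hwu.symm.2.2
      rw [e] at h1; omega
  have hxw' : T.N x w' (n + 3) := hbr.opp_nbr hbx hu hxu hw' huw.1
  have hyw' : T.N y w' (n + 3) := hbr.opp_nbr hby hu hyu hw' huw.1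
  have hw'r : P.d w' r = 1 := by rw [P.comm]; exact hw'
  obtain ⟨b2, hb2, hbb2⟩ := hyw'.persp hyb
  have F3 : F w' r b2 := hF y w' c' b r b2 hyw' hc' hyb hw'r hb2 hc'r.1 hbb2.1 F2
  exact hF w' x r b2 c b hxw'.symm hw'r hb2 hc hb hcr.symm.1 hbb2.symm.1 F3

end HomPair

/-! ### Panels in general position -/

namespace HomPair

variable {W W' : Type*} {n : ℕ} {P : ThickPolygon W (n + 3)} {P' : ThickPolygon W' (n + 3)}
  {T : HomPair P P'} {x y z w v a b a' b' s s' t u : W} {k : ℕ}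

variable (T) in
/-- No neighbour of `x` is identified with `a` by one homomorphism and with `b` by the other. -/
def Unmixed (x a b : W) : Prop :=
  ∀ z, P.d x z = 1 → ¬(T.σ z = T.σ a ∧ T.ψ z = T.ψ b) ∧ ¬(T.σ z = T.σ b ∧ T.ψ z = T.ψ a)

variable (T) in
/-- `a` and `b` are in general position, unmixed, and part of a triple in general position. -/
def Regular (x a b : W) : Prop :=
  T.Apart a b ∧ (∃ e, P.d x e = 1 ∧ T.Apart e a ∧ T.Apart e b) ∧ T.Unmixed x a b

theorem Unmixed.symm (h : T.Unmixed x a b) : T.Unmixed x b a := fun z hz => (h z hz).symm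

theorem inv_unmixed : T.Inv T.Unmixed := by
  intro x w a b a' b' hN ha hb ha' hb' haa hbb h z' hz'
  obtain ⟨z, hz, hzz⟩ := hN.symm.persp hz'
  have := h z hz
  rw [hN.persp_σ hz ha hz' ha' hzz.symm.1 haa, hN.persp_ψ hz hb hz' hb' hzz.symm.1 hbb,
    hN.persp_σ hz hb hz' hb' hzz.symm.1 hbb, hN.persp_ψ hz ha hz' ha' hzz.symm.1 haa] at this
  exact this

theorem inv_regular : T.Inv T.Regular := by
  intro x w a b a' b' hN ha hb ha' hb' haa hbb ⟨h1, ⟨e, he, h2, h3⟩, h4⟩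
  obtain ⟨e', he', hee⟩ := hN.persp he
  exact ⟨(hN.persp_apart ha hb ha' hb' haa hbb).1 h1,
    ⟨e', he', (hN.persp_apart he ha he' ha' hee.1 haa).1 h2,
      (hN.persp_apart he hb he' hb' hee.1 hbb).1 h3⟩,
    inv_unmixed x w a b a' b' hN ha hb ha' hb' haa hbb h4⟩

/-- With `w'` the neighbour of `w` facing `t`, the perspectivities from `s` to `w'` and on to `s'`
bring `v` back to `v` and take `a` through `w` to `a'`. -/
theorem Regular.shift (hN : T.N v w (n + 3)) (hs : P.d v s = 1) (hs' : P.d v s' = 1)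
    (ht : P.d v t = 1) (hst : T.Apart s t) (hst' : T.Apart s' t) (ha : P.d s a = 1)
    (haw : P.d a w = n + 1) (ha' : P.d s' a' = 1) (haw' : P.d a' w = n + 1)
    (h : T.Regular s v a) : T.Regular s' v a' := by
  obtain ⟨w', hw', htw⟩ := hN.persp ht
  have h1 := hN.opp_nbr hs ht hst hw' htw.1
  have h2 := hN.opp_nbr hs' ht hst' hw' htw.1
  have hvw' : T.N v w' (n + 2) := hN.opp hw'
  obtain ⟨v', hv', hvv⟩ := hvw'.desc
  have hw'w : P.d w' w = 1 := by rw [P.comm]; exact hw'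
  have hsv : P.d s v = 1 := by rw [P.comm]; exact hs
  have hsv' : P.d s' v = 1 := by rw [P.comm]; exact hs'
  have h3 := inv_regular s w' v a v' w h1 hsv ha hv' hw'w hvv.1 haw h
  exact inv_regular w' s' v' w v a' h2.symm hv' hw'w hsv' ha' hvv.symm.1
    (by rw [P.comm]; exact haw') h3

/-- The third neighbour `e` of `s` is apart from `a`, which faces `w`, so `e` is opposite `w` just
as `v` is. -/
theorem hasThird_of (hN : T.N v w (n + 3)) (hs : P.d v s = 1) (ha : P.d s a = 1)
    (haw : P.d a w = n + 1) (h : T.Regular s v a) : T.HasThird v s := by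
  obtain ⟨-, ⟨e, he, hev, hea⟩, -⟩ := h
  have hws : T.N w s (n + 2) := hN.symm.opp hs
  exact ⟨e, w, he, hev.symm, hN, (hws.up (by omega) ha (by rw [P.comm]; exact haw) he hea.symm).symm⟩

/-- A point of a panel is in general position to at least two of three pairwise unmixed points. -/
theorem exists_two_apart {r : W → Prop} {e1 e2 e3 : W} (h12 : T.Apart e1 e2) (h13 : T.Apart e1 e3)
    (h23 : T.Apart e2 e3) (u12 : T.Unmixed v e1 e2) (u13 : T.Unmixed v e1 e3)
    (u23 : T.Unmixed v e2 e3) (r1 : r e1) (r2 : r e2) (r3 : r e3) (hu : P.d v u = 1) :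
    ∃ s t, r s ∧ r t ∧ T.Apart s t ∧ T.Unmixed v s t ∧ T.Apart u s ∧ T.Apart u t := by
  have a12 := u12 u hu
  have a13 := u13 u hu
  have a23 := u23 u hu
  have key : (T.Apart u e1 ∧ T.Apart u e2) ∨ (T.Apart u e1 ∧ T.Apart u e3) ∨
      (T.Apart u e2 ∧ T.Apart u e3) := by
    obtain ⟨b12, c12⟩ := h12
    obtain ⟨b13, c13⟩ := h13
    obtain ⟨b23, c23⟩ := h23
    unfold Apart
    generalize T.σ u = su at *
    generalize T.ψ u = pu at *
    generalize T.σ e1 = s1 at *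
    generalize T.σ e2 = s2 at *
    generalize T.σ e3 = s3 at *
    generalize T.ψ e1 = p1 at *
    generalize T.ψ e2 = p2 at *
    generalize T.ψ e3 = p3 at *
    clear u12 u13 u23 hu r1 r2 r3
    grind
  rcases key with ⟨h, h'⟩ | ⟨h, h'⟩ | ⟨h, h'⟩
  · exact ⟨e1, e2, r1, r2, h12, u12, h, h'⟩
  · exact ⟨e1, e3, r1, r3, h13, u13, h, h'⟩
  · exact ⟨e2, e3, r2, r3, h23, u23, h, h'⟩

variable (T) in
/-- The panel of `v` is in general position with respect to the two homomorphisms. -/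
structure Good (v : W) : Prop where
  opp : ∃ w, T.N v w (n + 3) ∧ ∀ s a, P.d v s = 1 → P.d s a = 1 → P.d a w = n + 1 → T.Regular s v a
  triple : ∃ e1 e2 e3, P.d v e1 = 1 ∧ P.d v e2 = 1 ∧ P.d v e3 = 1 ∧ T.Apart e1 e2 ∧ T.Apart e1 e3 ∧
    T.Apart e2 e3
  unmixed : ∀ a b, P.d v a = 1 → P.d v b = 1 → T.Apart a b → T.Unmixed v a b

variable (T) in
/-- A pair of opposite chambers for which the first one is regular in the apartment they span. -/
structure Frame (v₀ v₁ w₀ w₁ a₀ a₁ : W) : Prop where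
  adj : P.d v₀ v₁ = 1
  adj' : P.d w₀ w₁ = 1
  opp₀ : T.N v₀ w₀ (n + 3)
  opp₁ : T.N v₁ w₁ (n + 3)
  adj₀ : P.d v₀ a₀ = 1
  adj₁ : P.d v₁ a₁ = 1
  dist₀ : P.d a₀ w₁ = n + 1
  dist₁ : P.d a₁ w₀ = n + 1
  regular₀ : T.Regular v₀ v₁ a₀
  regular₁ : T.Regular v₁ v₀ a₁

/-- The neighbours `v₀`, `a₁`, `e` of `v₁` are pairwise apart. `Regular.shift` spreads regularity
from `v₀` to `e` and `a₁`, and `Inv.move` makes the three pairwise unmixed. Every neighbour of `v₁`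
is then apart from two of them, so the same two tools reach it. -/
theorem Frame.good {v₀ v₁ w₀ w₁ a₀ a₁ : W} (h : T.Frame v₀ v₁ w₀ w₁ a₀ a₁) : T.Good v₁ := by
  have hv : P.d v₁ v₀ = 1 := by rw [P.comm]; exact h.adj
  obtain ⟨e, he, hev, hea⟩ := h.regular₁.2.1
  have hva : T.Apart v₀ a₁ := h.regular₁.1
  have Q0 : T.HasThird v₁ v₀ := hasThird_of h.opp₁ hv h.adj₀ h.dist₀ h.regular₀
  have U1 : T.Unmixed v₁ e v₀ :=
    inv_unmixed.move Q0 hv h.adj₁ he hva.symm hev h.regular₁.2.2.symm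
  have ex : ∀ s, P.d v₁ s = 1 → ∃ a, P.d s a = 1 ∧ P.d a w₁ = n + 1 := by
    intro s hs
    obtain ⟨a, ha, haw⟩ := (h.opp₁.symm.opp hs).desc
    exact ⟨a, ha, haw.symm.1⟩
  have R : ∀ s s' t, P.d v₁ s = 1 → P.d v₁ s' = 1 → P.d v₁ t = 1 → T.Apart s t → T.Apart s' t →
      (∃ a, P.d s a = 1 ∧ P.d a w₁ = n + 1 ∧ T.Regular s v₁ a) →
      ∀ a', P.d s' a' = 1 → P.d a' w₁ = n + 1 → T.Regular s' v₁ a' := by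
    rintro s s' t hs hs' ht hst hst' ⟨a, ha, haw, hr⟩ a' ha' haw'
    exact hr.shift h.opp₁ hs hs' ht hst hst' ha haw ha' haw'
  have R0 : ∃ a, P.d v₀ a = 1 ∧ P.d a w₁ = n + 1 ∧ T.Regular v₀ v₁ a :=
    ⟨a₀, h.adj₀, h.dist₀, h.regular₀⟩
  have R1 : ∃ a, P.d e a = 1 ∧ P.d a w₁ = n + 1 ∧ T.Regular e v₁ a := by
    obtain ⟨a, ha, haw⟩ := ex e he
    exact ⟨a, ha, haw, R v₀ e a₁ hv he h.adj₁ hva hea R0 a ha haw⟩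
  have R2 : ∃ a, P.d a₁ a = 1 ∧ P.d a w₁ = n + 1 ∧ T.Regular a₁ v₁ a := by
    obtain ⟨a, ha, haw⟩ := ex a₁ h.adj₁
    exact ⟨a, ha, haw, R e a₁ v₀ he h.adj₁ hv hev hva.symm R1 a ha haw⟩
  have Q1 : T.HasThird v₁ e := by
    obtain ⟨a, ha, haw, hr⟩ := R1
    exact hasThird_of h.opp₁ he ha haw hr
  have U2 : T.Unmixed v₁ a₁ e := inv_unmixed.move Q1 he hv h.adj₁ hev.symm hea.symm U1.symm
  have two := fun u (hu : P.d v₁ u = 1) => exists_two_apart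
    (r := fun s => P.d v₁ s = 1 ∧ ∃ a, P.d s a = 1 ∧ P.d a w₁ = n + 1 ∧ T.Regular s v₁ a)
    hva hev.symm hea.symm h.regular₁.2.2 U1.symm U2 ⟨hv, R0⟩ ⟨h.adj₁, R2⟩ ⟨he, R1⟩ hu
  have RA : ∀ u a, P.d v₁ u = 1 → P.d u a = 1 → P.d a w₁ = n + 1 → T.Regular u v₁ a := by
    intro u a hu ha haw
    obtain ⟨s, t, ⟨hs, Rs⟩, ⟨ht, -⟩, hst, -, -, hut⟩ := two u hu
    exact R s u t hs hu ht hst hut Rs a ha haw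
  have Q : ∀ s, P.d v₁ s = 1 → T.HasThird v₁ s := by
    intro s hs
    obtain ⟨a, ha, haw⟩ := ex s hs
    exact hasThird_of h.opp₁ hs ha haw (RA s a hs ha haw)
  refine ⟨⟨w₁, h.opp₁, RA⟩, ⟨v₀, a₁, e, hv, h.adj₁, he, hva, hev.symm, hea.symm⟩, ?_⟩
  intro a b ha hb hab
  obtain ⟨s, t, ⟨hs, -⟩, ⟨ht, -⟩, hst, U, hbs, -⟩ := two b hb
  -- First `t` is replaced by `b` against `s`, then `s` by `a` against `b`.
  have U3 := inv_unmixed.move (Q s hs) hs ht hb hst.symm hbs U.symm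
  exact inv_unmixed.move (Q b hb) hb hs ha hbs.symm hab U3.symm

theorem Good.two_apart (h : T.Good v) (hu : P.d v u = 1) :
    ∃ s t, P.d v s = 1 ∧ P.d v t = 1 ∧ T.Apart s t ∧ T.Unmixed v s t ∧ T.Apart u s ∧
      T.Apart u t := by
  obtain ⟨e1, e2, e3, h1, h2, h3, h12, h13, h23⟩ := h.triple
  exact exists_two_apart (r := fun s => P.d v s = 1) h12 h13 h23 (h.unmixed _ _ h1 h2 h12)
    (h.unmixed _ _ h1 h3 h13) (h.unmixed _ _ h2 h3 h23) h1 h2 h3 hu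

/-- Each of `a` and `b` is apart from at least two of three pairwise apart and unmixed neighbours,
so one of the three serves both. -/
theorem Good.exists_apart₂ (h : T.Good v) (ha : P.d v a = 1) (hb : P.d v b = 1) :
    ∃ t, P.d v t = 1 ∧ T.Apart a t ∧ T.Apart b t := by
  obtain ⟨e1, e2, e3, h1, h2, h3, h12, h13, h23⟩ := h.triple
  have a12 := h.unmixed _ _ h1 h2 h12
  have a13 := h.unmixed _ _ h1 h3 h13
  have a23 := h.unmixed _ _ h2 h3 h23
  have x12 := a12 a ha
  have x13 := a13 a ha
  have x23 := a23 a ha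
  have y12 := a12 b hb
  have y13 := a13 b hb
  have y23 := a23 b hb
  have key : (T.Apart a e1 ∧ T.Apart b e1) ∨ (T.Apart a e2 ∧ T.Apart b e2) ∨
      (T.Apart a e3 ∧ T.Apart b e3) := by
    obtain ⟨b12, c12⟩ := h12
    obtain ⟨b13, c13⟩ := h13
    obtain ⟨b23, c23⟩ := h23
    unfold Apart
    generalize T.σ a = su at *
    generalize T.ψ a = pu at *
    generalize T.σ b = sv at *
    generalize T.ψ b = pv at *
    generalize T.σ e1 = s1 at *
    generalize T.σ e2 = s2 at *
    generalize T.σ e3 = s3 at *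
    generalize T.ψ e1 = p1 at *
    generalize T.ψ e2 = p2 at *
    generalize T.ψ e3 = p3 at *
    clear a12 a13 a23 h ha hb
    grind
  rcases key with ⟨h, h'⟩ | ⟨h, h'⟩ | ⟨h, h'⟩
  · exact ⟨e1, h1, h, h'⟩
  · exact ⟨e2, h2, h, h'⟩
  · exact ⟨e3, h3, h, h'⟩

/-- `Frame.good` concludes for the second vertex of a frame, so it suffices to complete `v`, `u` to
one: `Good.unmixed` gives the regularity at `v`, and `Good.opp` the one at `u`. -/
theorem Good.of_adj (h : T.Good v) (hu : P.d v u = 1) : T.Good u := by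
  obtain ⟨w, hw, hR⟩ := h.opp
  obtain ⟨s, t, hs, ht, hst, U, hus, hut⟩ := h.two_apart hu
  obtain ⟨w₁, hw₁, htw⟩ := hw.persp ht
  obtain ⟨a, ha, haw⟩ := (hw.symm.opp hu).desc
  exact Frame.good ⟨hu, hw₁, hw, hw.opp_nbr hu ht hut hw₁ htw.1, ht, ha, htw.1, haw.symm.1,
    ⟨hut, ⟨s, hs, hus.symm, hst⟩, h.unmixed _ _ hu ht hut⟩, hR u a hu ha haw.symm.1⟩

theorem Good.all (h : T.Good v) (x : W) : T.Good x :=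
  P.induction_adj v h (fun _ _ hu hv => hv.of_adj hu) x

theorem Good.hasThird (h : T.Good v) (hs : P.d v s = 1) : T.HasThird v s := by
  obtain ⟨w, hw, hR⟩ := h.opp
  obtain ⟨a, ha, haw⟩ := (hw.symm.opp hs).desc
  exact hasThird_of hw hs ha haw.symm.1 (hR s a hs ha haw.symm.1)

theorem Good.trans_panel {F : W → W → Prop} (hF : T.Inv fun x a _ => F x a) (h : T.Good v)
    (ha : P.d v a = 1) (hb : P.d v b = 1) (hFa : F v a) : F v b := by
  obtain ⟨t, ht, hat, hbt⟩ := h.exists_apart₂ ha hb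
  exact hF.move (h.hasThird ht) ht ha hb hat hbt hFa

/-- Invariant properties of flags depend only on the type of the vertex. -/
theorem trans_even {F : W → W → Prop} (hF : T.Inv fun x a _ => F x a) (h : ∀ x, T.Good x)
    (ha : P.d v a = 1) (hFa : F v a) (hx : Even (P.d v x)) (hb : P.d x b = 1) : F x b := by
  have key : ∀ k x, P.d v x = 2 * k → ∀ b, P.d x b = 1 → F x b := by
    intro k
    induction k with
    | zero =>
      intro x hx b hb
      obtain rfl := P.eq_of_d _ _ hx
      exact (h _).trans_panel hF ha hb hFa
    | succ k ih =>
      intro x hx b hb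
      obtain ⟨y, hy, hyk⟩ := P.desc v x (2 * k + 1) (by omega)
      obtain ⟨z, hz, hzk⟩ := P.desc v y (2 * k) hyk
      have hyx : P.d y x = 1 := by rw [P.comm]; exact hy
      have hzy : P.d z y = 1 := by rw [P.comm]; exact hz
      have hFz := ih z hzk y hzy
      -- Since `t` is apart from `z` and `x`, its projection `w'` is opposite both, and flags pass
      -- from `z` through `w'` to `x`.
      obtain ⟨t, ht, hzt, hxt⟩ := (h y).exists_apart₂ hz hyx
      obtain ⟨w, hw, -⟩ := (h y).opp
      obtain ⟨w', hw', htw⟩ := hw.persp ht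
      have h1 := hw.opp_nbr hz ht hzt hw' htw.1
      have h2 := hw.opp_nbr hyx ht hxt hw' htw.1
      obtain ⟨c, hc, hyc⟩ := h1.persp hzy
      have h3 := hF z w' y y c c h1 hzy hzy hc hc hyc.1 hyc.1 hFz
      obtain ⟨c', hc', hcc'⟩ := h2.symm.persp hc
      exact (h x).trans_panel hF hc' hb
        (hF w' x c c c' c' h2.symm hc hc hc' hc' hcc'.1 hcc'.1 h3)
  obtain ⟨k, hk⟩ := hx
  exact key k x (by omega) b hb

/-! ### Comparing the fibres of the two homomorphisms -/

variable (T) in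
/-- On the panel of `v`, the second homomorphism factors through the first one. -/
def Refines (v : W) : Prop :=
  ∀ a b, P.d v a = 1 → P.d v b = 1 → T.σ a = T.σ b → T.ψ a = T.ψ b

variable (T) in
/-- On the panel of `x`, the `σ`-class of `a` is contained in the `ψ`-class. -/
def RefinesAt (x a : W) : Prop := ∀ z, P.d x z = 1 → T.σ z = T.σ a → T.ψ z = T.ψ a

theorem inv_refinesAt : T.Inv fun x a _ => T.RefinesAt x a := by
  intro x w a _ a' _ hN ha _ ha' _ haa _ h z' hz' e
  obtain ⟨z, hz, hzz⟩ := hN.symm.persp hz'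
  rw [← hN.persp_σ hz ha hz' ha' hzz.symm.1 haa] at e
  rw [← hN.persp_ψ hz ha hz' ha' hzz.symm.1 haa]
  exact h z hz e

/-- If neither inclusion holds, witnesses `y` and `z` of the two failures are apart, and `a` itself
mixes them. -/
theorem Good.refinesAt_or (h : T.Good v) (ha : P.d v a = 1) :
    T.RefinesAt v a ∨ ∀ z, P.d v z = 1 → T.ψ z = T.ψ a → T.σ z = T.σ a := by
  by_contra! hc
  obtain ⟨hc1, z, hz, h1, h2⟩ := hc
  unfold RefinesAt at hc1
  push Not at hc1
  obtain ⟨y, hy, h3, h4⟩ := hc1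
  have hA : T.Apart y z := ⟨fun e => h2 (by rw [← e, h3]), fun e => h4 (by rw [e, h1])⟩
  exact (h.unmixed y z hy hz hA a ha).1 ⟨h3.symm, h1.symm⟩

theorem swap_good (h : T.Good v) : T.swap.Good v := by
  have ap : ∀ {a b}, T.Apart a b → T.swap.Apart a b := fun h => ⟨h.2, h.1⟩
  have um : ∀ {x a b}, T.Unmixed x a b → T.swap.Unmixed x a b := fun h z hz =>
    ⟨fun e => (h z hz).2 ⟨e.2, e.1⟩, fun e => (h z hz).1 ⟨e.2, e.1⟩⟩
  refine ⟨?_, ?_, ?_⟩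
  · obtain ⟨w, hw, hR⟩ := h.opp
    refine ⟨w, hw.swap, fun s a hs ha haw => ?_⟩
    obtain ⟨h1, ⟨e, he, h2, h3⟩, h4⟩ := hR s a hs ha haw
    exact ⟨ap h1, ⟨e, he, ap h2, ap h3⟩, um h4⟩
  · obtain ⟨e1, e2, e3, h1, h2, h3, h12, h13, h23⟩ := h.triple
    exact ⟨e1, e2, e3, h1, h2, h3, ap h12, ap h13, ap h23⟩
  · exact fun a b ha hb hab => um (h.unmixed a b ha hb ⟨hab.2, hab.1⟩)

theorem parity_adj (hyz : P.d y z = 1) : Even (P.d x z) ↔ ¬ Even (P.d x y) := by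
  rcases P.step x y z hyz with h | h <;> rw [h, Nat.even_add_one]
  simp

/-- If σ glues `x1` to `x2` and ψ does not, a vertex `q` beyond `x2` has different distances from
`x1` in the two images. Prolonging by `p2` and `p3` leads to a panel of the other type, where σ
glues `p2` to the neighbour `r` of `p3` facing `q`. There ψ must glue them too, but `ψ p2` is
opposite `ψ q` and `ψ r` is too close to it. -/
theorem refines_of_even (h : ∀ x, T.Good x) {o : W} (hE : ∀ v, Even (P.d o v) → T.Refines v)
    (v : W) : T.Refines v := by
  by_cases hv : Even (P.d o v)
  · exact hE v hv
  intro x1 x2 hx1 hx2 hσ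
  by_contra hψ
  have hv1 : P.d x1 v = 1 := by rw [P.comm]; exact hx1
  obtain ⟨w, hw, -⟩ := (h v).opp
  obtain ⟨q', hq', hxq'⟩ := (hw.symm.opp hx2).symm.desc
  obtain ⟨q, hq, hxq⟩ := hxq'.desc
  have c1 := P.step q v x2 hx2
  have hx2' : P.d x2 v = 1 := by rw [P.comm]; exact hx2
  have hvq : T.N v q (n + 1) := by
    have h0 := P.comm q v
    have h1 := P.comm q x2
    have h2 := hxq.1
    refine (hw.opp hq').down hq ?_
    omega
  have hσq : P'.d (T.σ x1) (T.σ q) = n := by rw [hσ]; exact hxq.2.1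
  have hψv := T.homψ _ _ hv1
  have hψq : P'.d (T.ψ x1) (T.ψ q) = n + 2 := by
    have h1 := P'.step (T.ψ q) _ _ (T.homψ _ _ hx1)
    have h2 := P'.comm (T.ψ q) (T.ψ v)
    have h3 := P'.comm (T.ψ q) (T.ψ x1)
    have h4 := hvq.2.2
    have h5 : P'.d (T.ψ q) (T.ψ x1) ≠ n := fun e => hψ <|
      P'.uniq (T.ψ q) (T.ψ v) _ _ n (by omega) (by omega) (T.homψ _ _ hx1) (T.homψ _ _ hx2) e
        (by rw [P'.comm]; exact hxq.2.2)
    omega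
  obtain ⟨p2, hp2, hp2v, hp2q⟩ : ∃ p2, P.d x1 p2 = 1 ∧ T.Apart v p2 ∧
      P'.d (T.σ p2) (T.σ q) = n + 1 := by
    obtain ⟨s, t, hs, ht, hst, -, hvs, hvt⟩ := (h x1).two_apart hv1
    have h0 := P'.comm (T.σ q) (T.σ x1)
    have h1 := P'.step (T.σ q) _ _ (T.homσ _ _ hs)
    have h2 := P'.step (T.σ q) _ _ (T.homσ _ _ ht)
    by_cases es : P'.d (T.σ q) (T.σ s) = n + 1
    · exact ⟨s, hs, hvs, by rw [P'.comm]; exact es⟩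
    by_cases et : P'.d (T.σ q) (T.σ t) = n + 1
    · exact ⟨t, ht, hvt, by rw [P'.comm]; exact et⟩
    exact absurd (P'.uniq (T.σ q) (T.σ x1) _ _ (P'.d (T.σ q) (T.σ s)) (by omega) (by omega)
      (T.homσ _ _ hs) (T.homσ _ _ ht) rfl (by omega)) hst.1
  have hψp : P'.d (T.ψ p2) (T.ψ q) = n + 3 := by
    have h1 := P'.step (T.ψ q) _ _ (T.homψ _ _ hp2)
    have h2 := P'.comm (T.ψ q) (T.ψ x1)
    have h3 := P'.comm (T.ψ q) (T.ψ p2)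
    have h4 : P'.d (T.ψ q) (T.ψ p2) ≠ n + 1 := fun e => hp2v.2 <|
      P'.uniq (T.ψ q) (T.ψ x1) _ _ (n + 1) (by omega) (by omega) (T.homψ _ _ hv1)
        (T.homψ _ _ hp2) (by rw [P'.comm]; exact hvq.2.2) e
    omega
  have hp1 : P.d p2 x1 = 1 := by rw [P.comm]; exact hp2
  obtain ⟨p3, -, hp3, -, -, -, hp3x, -⟩ := (h p2).two_apart hp1
  have hσ3 : P'.d (T.σ p3) (T.σ q) = n + 2 := by
    have h1 := P'.step (T.σ q) _ _ (T.homσ _ _ hp3)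
    have h2 := P'.comm (T.σ q) (T.σ p2)
    have h3 := P'.comm (T.σ q) (T.σ p3)
    have h4 : P'.d (T.σ q) (T.σ p3) ≠ n := fun e => hp3x.1 <|
      P'.uniq (T.σ q) (T.σ p2) _ _ n (by omega) (by omega) (T.homσ _ _ hp1)
        (T.homσ _ _ hp3) (by rw [P'.comm]; exact hσq) e
    omega
  have hd3 : P.d q p3 = n + 2 := by
    obtain ⟨j, hj⟩ := T.homσ.d_le p3 q
    have := P.d_le p3 q
    have := P.comm p3 q
    omega
  obtain ⟨r, hr, hqr⟩ := P.desc q p3 (n + 1) hd3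
  have hp32 : P.d p3 p2 = 1 := by rw [P.comm]; exact hp3
  have hev : Even (P.d o p3) := by
    rw [parity_adj hp3, parity_adj hp2, parity_adj hx1]
    simpa using hv
  have hσr : T.σ r = T.σ p2 := by
    refine P'.uniq (T.σ q) (T.σ p3) _ _ (n + 1) (by rw [P'.comm]; omega) (by omega)
      (T.homσ _ _ hr) (T.homσ _ _ hp32) ?_ (by rw [P'.comm]; omega)
    obtain ⟨j, hj⟩ := T.homσ.d_le q r
    have h1 := P'.step (T.σ q) _ _ (T.homσ _ _ hr)
    have h2 := P'.comm (T.σ q) (T.σ p3)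
    omega
  have hψr := hE p3 hev r p2 hr hp32 hσr
  obtain ⟨j, hj⟩ := T.homψ.d_le q r
  rw [hψr] at hj
  have := P'.comm (T.ψ q) (T.ψ p2)
  omega

/-- From a vertex `u` at distance `n + 2` from both `x` and `y`, geodesics to `x` and `y` have the
same σ-image, because geodesics shorter than the diameter are unique. Their ψ-images agree step by
step. -/
theorem eq_of_refines (h : ∀ x, T.Good x) (hR : ∀ v, T.Refines v) {x y : W}
    (hxy : T.σ x = T.σ y) : T.ψ x = T.ψ y := by
  -- `u` and `u'` have the same images, hence a common opposite `w`; both panels are compared on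
  -- that of `w`.
  have local_step : ∀ u u' x x', T.σ u = T.σ u' → T.ψ u = T.ψ u' → P.d u x = 1 → P.d u' x' = 1 →
      T.σ x = T.σ x' → T.ψ x = T.ψ x' := by
    intro u u' x x' hσ hψ hx hx' e
    obtain ⟨w, hw, -⟩ := (h u).opp
    have hw' : T.N u' w (n + 3) := by
      refine N_of_eq ?_ ?_ (by omega)
      · rw [← hσ]; exact hw.2.1
      · rw [← hψ]; exact hw.2.2
    obtain ⟨g, hg, hxg⟩ := hw.persp hx
    obtain ⟨g', hg', hxg'⟩ := hw'.persp hx'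
    have e1 : T.σ g = T.σ g' :=
      T.homσ.eq_of_eq_persp rfl hw.2.1 hx hg hg' hxg.1 hxg'.1 e
    exact T.homψ.eq_of_eq_persp hψ hw.symm.2.2 hg hx hx' hxg.symm.1 hxg'.symm.1
      (hR w g g' hg hg' e1)
  have key : ∀ k u u', k < n + 3 → T.σ u = T.σ u' → T.ψ u = T.ψ u' → P.d x u = k → P.d y u' = k →
      P'.d (T.σ x) (T.σ u) = k → T.ψ x = T.ψ y := by
    intro k
    induction k with
    | zero =>
      intro u u' _ _ hψ h1 h2 _
      rw [P.eq_of_d _ _ h1, P.eq_of_d _ _ h2, hψ]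
    | succ k ih =>
      intro u u' hk hσ hψ h1 h2 h3
      obtain ⟨z, hz, hxz⟩ := P.desc _ _ _ h1
      obtain ⟨z', hz', hyz⟩ := P.desc _ _ _ h2
      have k1 := P'.step (T.σ x) _ _ (T.homσ _ _ hz)
      have k2 := P'.step (T.σ x) _ _ (T.homσ _ _ hz')
      obtain ⟨j, hj⟩ := T.homσ.d_le x z
      obtain ⟨l, hl⟩ := T.homσ.d_le y z'
      rw [← hxy] at hl
      rw [← hσ] at k2
      have e : T.σ z = T.σ z' :=
        P'.uniq (T.σ x) (T.σ u) _ _ k h3 hk (T.homσ _ _ hz) (hσ ▸ T.homσ _ _ hz')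
          (by omega) (by omega)
      exact ih z z' (by omega) e (local_step u u' z z' hσ hψ hz hz' e) hxz hyz (by omega)
  obtain ⟨w, hw, -⟩ := (h x).opp
  obtain ⟨u, hu, -⟩ := P.thick w w w
  have hxu := hw.opp hu
  refine key (n + 2) u u (by omega) rfl rfl hxu.1 ?_ hxu.2.1
  obtain ⟨j, hj⟩ := T.homσ.d_le y u
  have := P.d_le y u
  have := hxu.2.1
  rw [← hxy] at hj
  omega

/-- Of two homomorphisms in general position, one factors through the other. -/
theorem comparable (h : ∀ x, T.Good x) (o : W) :
    (∀ x y, T.σ x = T.σ y → T.ψ x = T.ψ y) ∨ (∀ x y, T.ψ x = T.ψ y → T.σ x = T.σ y) := by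
  obtain ⟨a, ha, -⟩ := P.thick o o o
  rcases (h o).refinesAt_or ha with h1 | h1
  · refine Or.inl fun x y => eq_of_refines h (refines_of_even h (o := o) fun v hv a' b ha' hb e => ?_)
    exact trans_even inv_refinesAt h ha h1 hv hb a' ha' e
  · have h' : ∀ x, T.swap.Good x := fun x => swap_good (h x)
    refine Or.inr fun x y => eq_of_refines (T := T.swap) h'
      (refines_of_even h' (o := o) fun v hv a' b ha' hb e => ?_)
    exact trans_even (T := T.swap) inv_refinesAt h' ha h1 hv hb a' ha' e

end HomPair

/-! ### Distances, galleries and apartments in an `m`-gon -/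

namespace MGon

section Distance

variable {V : Type*} {m : ℕ} (Δ : MGon V m)

theorem dist_le (x y : V) : Δ.graph.dist x y ≤ m := by
  have h := SimpleGraph.edist_le_ediam (G := Δ.graph) (u := x) (v := y)
  rw [Δ.ediam_eq, ← (Δ.connected x y).coe_dist_eq_edist] at h
  exact_mod_cast h

theorem dist_parity (x y : V) : Even (Δ.graph.dist x y) ↔ Δ.type x = Δ.type y := by
  obtain ⟨p, hp⟩ := Δ.connected.exists_walk_length_eq_dist x y
  rw [← hp, Δ.type.even_length_iff_congr p]
  cases Δ.type x <;> cases Δ.type y <;> simp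

theorem dist_step (x y z : V) (h : Δ.graph.Adj y z) :
    Δ.graph.dist x z = Δ.graph.dist x y + 1 ∨ Δ.graph.dist x y = Δ.graph.dist x z + 1 := by
  have h1 : Δ.graph.dist x z ≠ Δ.graph.dist x y := by
    intro e
    have e1 := Δ.dist_parity x z
    have e2 := Δ.dist_parity x y
    have e3 := Δ.type.valid h
    rw [e] at e1
    revert e1 e2 e3
    cases Δ.type x <;> cases Δ.type y <;> cases Δ.type z <;> simp +contextual
  have h2 := Δ.connected.dist_triangle (u := x) (v := y) (w := z)
  have h3 := Δ.connected.dist_triangle (u := x) (v := z) (w := y)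
  have h4 := SimpleGraph.dist_eq_one_iff_adj.2 h
  have h5 := SimpleGraph.dist_eq_one_iff_adj.2 h.symm
  omega

theorem dist_desc (x y : V) (k : ℕ) (h : Δ.graph.dist x y = k + 1) :
    ∃ z, Δ.graph.Adj y z ∧ Δ.graph.dist x z = k := by
  obtain ⟨p, hp⟩ := Δ.connected.exists_walk_length_eq_dist y x
  cases p with
  | nil => simp at h
  | cons hyz p =>
    rename_i z
    refine ⟨z, hyz, ?_⟩
    have h1 := SimpleGraph.dist_le p
    rw [SimpleGraph.dist_comm] at h1
    have h2 := Δ.dist_step x y z hyz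
    rw [SimpleGraph.Walk.length_cons, SimpleGraph.dist_comm] at hp
    omega

/-- The union of the two paths has fewer than `2 * m` edges, too few for a cycle, and in an acyclic
graph paths are unique. -/
theorem path_unique_of_length_lt {x y : V} (p q : Δ.graph.Walk x y) (hp : p.IsPath)
    (hq : q.IsPath) (h : p.length + q.length < 2 * m) : p = q := by
  classical
  let S : Finset (Sym2 V) := p.edges.toFinset ∪ q.edges.toFinset
  let H : SimpleGraph V := SimpleGraph.fromEdgeSet (S : Set (Sym2 V))
  have hpe : ∀ e ∈ p.edges, e ∈ Δ.graph.edgeSet := fun e he => p.edges_subset_edgeSet he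
  have hqe : ∀ e ∈ q.edges, e ∈ Δ.graph.edgeSet := fun e he => q.edges_subset_edgeSet he
  have hpH : ∀ e ∈ p.edges, e ∈ H.edgeSet := by
    intro e he
    rw [SimpleGraph.edgeSet_fromEdgeSet]
    exact ⟨by simp [S, he], fun hd => Δ.graph.not_isDiag_of_mem_edgeSet (hpe e he) hd⟩
  have hqH : ∀ e ∈ q.edges, e ∈ H.edgeSet := by
    intro e he
    rw [SimpleGraph.edgeSet_fromEdgeSet]
    exact ⟨by simp [S, he], fun hd => Δ.graph.not_isDiag_of_mem_edgeSet (hqe e he) hd⟩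
  have hHS : ∀ e ∈ H.edgeSet, e ∈ S := by
    intro e he
    rw [SimpleGraph.edgeSet_fromEdgeSet] at he
    exact he.1
  have hac : H.IsAcyclic := by
    intro a c hc
    have hcG : ∀ e ∈ c.edges, e ∈ Δ.graph.edgeSet := by
      intro e he
      have := hHS e (c.edges_subset_edgeSet he)
      simp only [S, Finset.mem_union, List.mem_toFinset] at this
      exact this.elim (hpe e) (hqe e)
    have h1 := SimpleGraph.egirth_le_length (hc.transfer hcG)
    rw [Δ.egirth_eq, SimpleGraph.Walk.length_transfer] at h1
    have h2 : 2 * m ≤ c.length := by exact_mod_cast h1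
    have h3 : c.edges.toFinset.card = c.length := by
      rw [List.toFinset_card_of_nodup hc.edges_nodup, SimpleGraph.Walk.length_edges]
    have h4 : c.edges.toFinset ⊆ S := fun e he =>
      hHS e (c.edges_subset_edgeSet (List.mem_toFinset.1 he))
    have h5 := Finset.card_le_card h4
    have h6 := Finset.card_union_le p.edges.toFinset q.edges.toFinset
    have h7 := List.toFinset_card_le p.edges
    have h8 := List.toFinset_card_le q.edges
    rw [SimpleGraph.Walk.length_edges] at h7 h8
    have h9 : S.card ≤ _ := h6
    omega
  have := (hac.subsingleton_path x y).elim ⟨_, hp.transfer hpH⟩ ⟨_, hq.transfer hqH⟩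
  have h2 : p.transfer H hpH = q.transfer H hqH := congrArg Subtype.val this
  have h3 := congrArg SimpleGraph.Walk.support h2
  rw [SimpleGraph.Walk.support_transfer, SimpleGraph.Walk.support_transfer] at h3
  exact SimpleGraph.Walk.ext_support h3

theorem dist_uniq (x y z z' : V) (k : ℕ) (h : Δ.graph.dist x y = k + 1) (hk : k + 1 < m)
    (hz : Δ.graph.Adj y z) (hz' : Δ.graph.Adj y z') (hxz : Δ.graph.dist x z = k)
    (hxz' : Δ.graph.dist x z' = k) : z = z' := by
  obtain ⟨p, hp⟩ := Δ.connected.exists_walk_length_eq_dist z x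
  obtain ⟨p', hp'⟩ := Δ.connected.exists_walk_length_eq_dist z' x
  rw [SimpleGraph.dist_comm] at hp hp' h
  have e := Δ.path_unique_of_length_lt (SimpleGraph.Walk.cons hz p) (SimpleGraph.Walk.cons hz' p')
    (SimpleGraph.Walk.isPath_of_length_eq_dist _ (by simp [hp, hxz, h]))
    (SimpleGraph.Walk.isPath_of_length_eq_dist _ (by simp [hp', hxz', h]))
    (by simp only [SimpleGraph.Walk.length_cons]; omega)
  injection e

theorem type_ne_of_adj {a b : V} (h : Δ.graph.Adj a b) : Δ.type b = !Δ.type a := by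
  have := Δ.type.valid h
  revert this
  cases Δ.type a <;> cases Δ.type b <;> simp

end Distance

variable {V : Type*} {n : ℕ} (Δ : MGon V (n + 3))

variable {Δ} in
theorem IsThick.exists_adj (h : Δ.IsThick) (y a b : V) :
    ∃ z, Δ.graph.Adj y z ∧ z ≠ a ∧ z ≠ b := by
  by_contra! hc
  have hsub : Δ.graph.neighborSet y ⊆ {a, b} := by
    intro z hz
    by_cases hza : z = a
    · exact Or.inl hza
    · exact Or.inr (hc z hz hza)
  have h1 := (h y).trans (Set.encard_le_encard hsub)
  have h2 := h1.trans (Set.encard_insert_le {b} a)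
  rw [Set.encard_singleton] at h2
  exact absurd h2 (by norm_num)

/-- The thick polygon given by a thick `m`-gon. -/
noncomputable def polygon (h : Δ.IsThick) : ThickPolygon V (n + 3) where
  d := Δ.graph.dist
  d_le := Δ.dist_le
  comm _ _ := SimpleGraph.dist_comm
  eq_of_d _ _ := Δ.connected.dist_eq_zero_iff.1
  d_self _ := SimpleGraph.dist_self
  step x y z hyz := Δ.dist_step x y z (SimpleGraph.dist_eq_one_iff_adj.1 hyz)
  desc x y k hk := by simpa only [SimpleGraph.dist_eq_one_iff_adj] using Δ.dist_desc x y k hk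
  uniq x y z z' k hk hlt hz hz' := Δ.dist_uniq x y z z' k hk hlt
    (SimpleGraph.dist_eq_one_iff_adj.1 hz) (SimpleGraph.dist_eq_one_iff_adj.1 hz')
  thick y a b := by simpa only [SimpleGraph.dist_eq_one_iff_adj] using h.exists_adj y a b

section Chambers

variable {V : Type*} {m : ℕ} {Δ : MGon V m}

theorem isVertex_chamberOf {a b v : V} (h : Δ.graph.Adj a b) :
    Δ.IsVertex v (Δ.chamberOf a b h) ↔ v = a ∨ v = b := by
  unfold IsVertex chamberOf
  split_ifs
  · rfl
  · exact or_comm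

theorem eq_chamberOf {C : Δ.Chamber} {x y : V} (hx : Δ.IsVertex x C) (hy : Δ.IsVertex y C)
    (hxy : x ≠ y) : ∃ h : Δ.graph.Adj x y, C = Δ.chamberOf x y h := by
  have hC : C = Δ.chamberOf C.1.1 C.1.2 C.2.1 := (Δ.chamberOf_of_false C.2.1 C.2.2).symm
  rcases hx with rfl | rfl <;> rcases hy with rfl | rfl
  · exact absurd rfl hxy
  · exact ⟨C.2.1, hC⟩
  · exact ⟨C.2.1.symm, by rw [Δ.chamberOf_comm]; exact hC⟩
  · exact absurd rfl hxy

theorem exists_eq_chamberOf {C : Δ.Chamber} {x : V} (hx : Δ.IsVertex x C) :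
    ∃ (y : V) (h : Δ.graph.Adj x y), C = Δ.chamberOf x y h := by
  rcases hx with rfl | rfl
  · exact ⟨C.1.2, eq_chamberOf (.inl rfl) (.inr rfl) C.2.1.ne⟩
  · exact ⟨C.1.1, eq_chamberOf (.inr rfl) (.inl rfl) C.2.1.ne'⟩

theorem chamberIn_chamberOf {a b : V} (h : Δ.graph.Adj a b) (A : Δ.graph.Subgraph) :
    Δ.ChamberIn (Δ.chamberOf a b h) A ↔ A.Adj a b := by
  unfold ChamberIn chamberOf
  split_ifs
  · rfl
  · exact A.adj_comm _ _

theorem exists_gallery {x y : V} (p : Δ.graph.Walk x y) : ∀ (C D : Δ.Chamber), Δ.IsVertex x C →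
    Δ.IsVertex y D → ∃ q : Δ.chamberGraph.Walk C D, q.length ≤ p.length + 1 := by
  have short : ∀ (x : V) (C D : Δ.Chamber), Δ.IsVertex x C → Δ.IsVertex x D →
      ∃ q : Δ.chamberGraph.Walk C D, q.length ≤ 1 := by
    intro x C D hC hD
    by_cases h : C = D
    · subst h
      exact ⟨.nil, by simp⟩
    · have hadj : Δ.chamberGraph.Adj C D := ⟨h, x, hC, hD⟩
      exact ⟨hadj.toWalk, by simp⟩
  induction p with
  | nil => intro C D hC hD; simpa using short _ C D hC hD
  | cons hadj p ih =>
    intro C D hC hD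
    obtain ⟨q, hq⟩ := short _ C (Δ.chamberOf _ _ hadj) hC ((isVertex_chamberOf hadj).2 (.inl rfl))
    obtain ⟨q', hq'⟩ := ih (Δ.chamberOf _ _ hadj) D ((isVertex_chamberOf hadj).2 (.inr rfl)) hD
    refine ⟨q.append q', ?_⟩
    rw [SimpleGraph.Walk.length_append, SimpleGraph.Walk.length_cons]
    omega

/-- A walk between vertices of two chambers yields a gallery longer by at most one. -/
theorem Opposite.le_dist {C D : Δ.Chamber} (h : Δ.Opposite C D) {x y : V} (hx : Δ.IsVertex x C)
    (hy : Δ.IsVertex y D) : m ≤ Δ.graph.dist x y + 1 := by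
  obtain ⟨p, hp⟩ := Δ.connected.exists_walk_length_eq_dist x y
  obtain ⟨q, hq⟩ := exists_gallery p C D hx hy
  have h1 := SimpleGraph.dist_le q
  have h2 : Δ.chamberGraph.dist C D = m := h
  omega

end Chambers

open scoped Fin.CommRing in
/-- A cyclic enumeration of the vertices of an apartment. -/
theorem IsApartment.exists_cycle {Δ : MGon V (n + 3)} {A : Δ.graph.Subgraph} (hA : Δ.IsApartment A)
    {y : V} (hy : y ∈ A.verts) : ∃ c : ℕ → V, c 0 = y ∧ (∀ k, Δ.graph.Adj (c k) (c (k + 1))) ∧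
      (∀ k, c (k + (2 * n + 6)) = c k) ∧ (∀ w ∈ A.verts, ∃ k, k < 2 * n + 6 ∧ w = c k) ∧
      (∀ k z, A.Adj (c (k + 1)) z → z = c k ∨ z = c (k + 2)) := by
  obtain ⟨e⟩ := hA
  have hN : 2 * (n + 3) = 2 * n + 4 + 2 := by ring
  rw [hN] at e
  have hcast : ((2 * n + 6 : ℕ) : Fin (2 * n + 4 + 2)) = 0 := Fin.natCast_self _
  refine ⟨fun k => (e.symm (e ⟨y, hy⟩ + (k : Fin (2 * n + 4 + 2)))).1, ?_, ?_, ?_, ?_, ?_⟩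
  · simp
  · intro k
    apply A.adj_sub
    have : A.coe.Adj (e.symm (e ⟨y, hy⟩ + (k : Fin (2 * n + 4 + 2))))
        (e.symm (e ⟨y, hy⟩ + ((k + 1 : ℕ) : Fin (2 * n + 4 + 2)))) := by
      rw [e.symm.map_adj_iff, SimpleGraph.cycleGraph_adj]
      right
      push_cast
      ring
    exact this
  · intro k
    simp only [Nat.cast_add k, hcast, add_zero]
  · intro w hw
    refine ⟨(e ⟨w, hw⟩ - e ⟨y, hy⟩).val, (e ⟨w, hw⟩ - e ⟨y, hy⟩).isLt, ?_⟩
    simp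
  · intro k z hz
    have hz' : z ∈ A.verts := A.edge_vert hz.symm
    have h : A.coe.Adj (e.symm (e ⟨y, hy⟩ + ((k + 1 : ℕ) : Fin (2 * n + 4 + 2)))) ⟨z, hz'⟩ := hz
    rw [← e.symm_apply_apply ⟨z, hz'⟩, e.symm.map_adj_iff, SimpleGraph.cycleGraph_adj] at h
    rcases h with h | h
    · left
      have : e ⟨z, hz'⟩ = e ⟨y, hy⟩ + (k : Fin (2 * n + 4 + 2)) := by
        have h2 := sub_eq_iff_eq_add.1 h
        push_cast at h2
        linear_combination -h2
      beta_reduce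
      rw [← this, e.symm_apply_apply]
    · right
      have : e ⟨z, hz'⟩ = e ⟨y, hy⟩ + ((k + 2 : ℕ) : Fin (2 * n + 4 + 2)) := by
        have h2 := sub_eq_iff_eq_add.1 h
        push_cast at h2 ⊢
        linear_combination h2
      beta_reduce
      rw [← this, e.symm_apply_apply]

theorem dist_le_of_adj_succ {Δ : MGon V (n + 3)} {c : ℕ → V}
    (hc : ∀ k, Δ.graph.Adj (c k) (c (k + 1))) (i k : ℕ) :
    Δ.graph.dist (c i) (c (i + k)) ≤ k := by
  induction k with
  | zero => simp
  | succ k ih =>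
    have h2 := Δ.connected.dist_triangle (u := c i) (v := c (i + k)) (w := c (i + (k + 1)))
    have h4 := SimpleGraph.dist_eq_one_iff_adj.2 (hc (i + k))
    rw [show i + k + 1 = i + (k + 1) by ring] at h4
    omega

theorem IsApartment.eq_of_adj {Δ : MGon V (n + 3)} {A : Δ.graph.Subgraph} (hA : Δ.IsApartment A)
    {x y z z' : V} (hy : A.Adj x y) (hz : A.Adj x z) (hz' : A.Adj x z') (hzy : z ≠ y)
    (hzy' : z' ≠ y) : z = z' := by
  obtain ⟨c, h0, hadj, hper, -, hnb⟩ := hA.exists_cycle (A.edge_vert hy)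
  have h1 : c (2 * n + 5 + 1) = x := by rw [← h0, ← hper 0]; congr 1; ring
  have a1 := hnb (2 * n + 5) y (by rw [h1]; exact hy)
  have a2 := hnb (2 * n + 5) z (by rw [h1]; exact hz)
  have a3 := hnb (2 * n + 5) z' (by rw [h1]; exact hz')
  grind

/-- Being at distance `n + 3` from `y` forces `w` halfway round the cycle. As `z` lies two steps
from `y`, the cycle joins it to `w` in `n + 1` steps, and no shorter walk is possible. -/
theorem IsApartment.dist_eq {Δ : MGon V (n + 3)} {A : Δ.graph.Subgraph} (hA : Δ.IsApartment A)
    {x y z w : V} (hxy : A.Adj x y) (hxz : A.Adj x z) (hzy : z ≠ y) (hw : w ∈ A.verts)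
    (hd : Δ.graph.dist y w = n + 3) : Δ.graph.dist z w = n + 1 := by
  obtain ⟨c, rfl, hadj, hper, hsurj, hnb⟩ := hA.exists_cycle (A.edge_vert hxy.symm)
  obtain ⟨k, hk, rfl⟩ := hsurj w hw
  have h1 := dist_le_of_adj_succ hadj 0 k
  have h2 := dist_le_of_adj_succ hadj k (2 * n + 6 - k)
  rw [show k + (2 * n + 6 - k) = 0 + (2 * n + 6) by omega, hper, SimpleGraph.dist_comm] at h2
  rw [zero_add] at h1
  obtain rfl : k = n + 3 := by omega
  have h3 : Δ.graph.dist z (c (n + 3)) ≤ n + 1 := by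
    have hx := hnb (2 * n + 5) x (by
      rw [show 2 * n + 5 + 1 = 0 + (2 * n + 6) by ring, hper]; exact hxy.symm)
    rcases hx with rfl | rfl
    · have hz := hnb (2 * n + 4) z hxz
      rcases hz with rfl | rfl
      · have := dist_le_of_adj_succ hadj (n + 3) (n + 1)
        rwa [show n + 3 + (n + 1) = 2 * n + 4 by ring, SimpleGraph.dist_comm] at this
      · exact absurd (by rw [← hper 0]; congr 1; ring) hzy
    · rw [show 2 * n + 5 + 2 = 1 + (2 * n + 6) by ring, hper] at hxz
      have hz := hnb 0 z hxz
      rcases hz with rfl | rfl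
      · exact absurd rfl hzy
      · have := dist_le_of_adj_succ hadj 2 (n + 1)
        rwa [show 2 + (n + 1) = n + 3 by ring] at this
  have h4 := Δ.dist_step (c (n + 3)) x (c 0) (A.adj_sub hxy)
  have h5 := Δ.dist_step (c (n + 3)) x z (A.adj_sub hxz)
  have h6 := SimpleGraph.dist_comm (G := Δ.graph) (u := c (n + 3)) (v := z)
  have h7 := SimpleGraph.dist_comm (G := Δ.graph) (u := c (n + 3)) (v := c 0)
  have h8 := Δ.dist_le x (c (n + 3))
  have h9 := SimpleGraph.dist_comm (G := Δ.graph) (u := c (n + 3)) (v := x)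
  omega

end MGon

/-! ### Surjective endomorphisms, paired with the identity -/

open Filter Topology

namespace ThickPolygon

variable {W W' : Type*} {n : ℕ} {P : ThickPolygon W (n + 3)} {P' : ThickPolygon W' (n + 3)}

theorem IsHom.exists_adj_ne {f : W → W'} (hf : P.IsHom P' f) (hs : Function.Surjective f) (v : W)
    (a b : W') : ∃ z, P.d v z = 1 ∧ f z ≠ a ∧ f z ≠ b := by
  obtain ⟨c, hc, hca, hcb⟩ := P'.thick (f v) a b
  obtain ⟨z, hz, rfl⟩ := hf.exists_lift hs hc
  exact ⟨z, hz, hca, hcb⟩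

end ThickPolygon

namespace HomPair

variable {W : Type*} {n : ℕ} {P : ThickPolygon W (n + 3)}

/-- A surjective endomorphism, paired with the identity. -/
def withId {f : W → W} (hf : P.IsHom P f) (hs : Function.Surjective f) : HomPair P P where
  σ := f
  ψ := id
  homσ := hf
  homψ := fun _ _ h => h
  surjσ := hs
  surjψ := Function.surjective_id

variable {f : W → W} {hf : P.IsHom P f} {hs : Function.Surjective f}

theorem withId_apart {a b : W} (h : f a ≠ f b) : (withId hf hs).Apart a b :=
  ⟨h, fun e => h (congrArg f e)⟩

theorem withId_N {x w : W} (h : P.d (f x) (f w) = n + 3) : (withId hf hs).N x w (n + 3) := by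
  refine N_of_eq h ?_ (by omega)
  obtain ⟨j, hj⟩ := hf.d_le x w
  have := P.d_le x w
  change P.d x w = n + 3
  omega

/-- With the identity as second map, a mixing `z` equals `a` or `b`, and then `f a = f b`.
Separation by `f` is thus all that is needed. -/
theorem withId_regular {v a b : W} (h : f a ≠ f b) : (withId hf hs).Regular v a b := by
  obtain ⟨e, he, ha, hb⟩ := hf.exists_adj_ne hs v (f a) (f b)
  refine ⟨withId_apart h, ⟨e, he, withId_apart ha, withId_apart hb⟩, fun z hz => ⟨?_, ?_⟩⟩
  · rintro ⟨h1, h2⟩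
    have h2 : z = b := h2
    exact h (by rw [← h2]; exact h1.symm)
  · rintro ⟨h1, h2⟩
    have h2 : z = a := h2
    exact h (by rw [← h2]; exact h1)

theorem withId_good (v : W) : (withId hf hs).Good v := by
  obtain ⟨w', hw'⟩ := P.exists_opp (f v)
  obtain ⟨w₀, rfl⟩ := hs w'
  have N0 : (withId hf hs).N v w₀ (n + 3) := withId_N hw'
  obtain ⟨v₁, hv₁, -⟩ := P.thick v v v
  have N1 := N0.symm.opp hv₁
  obtain ⟨a₁, ha₁, Na₁⟩ := N1.desc
  obtain ⟨t, ht, Nt⟩ := N1.symm.desc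
  obtain ⟨w₁, hw₁, hne, -⟩ := hf.exists_adj_ne hs w₀ (f t) (f t)
  have N2 : (withId hf hs).N v₁ w₁ (n + 3) :=
    N1.symm.up (by omega) ht Nt.1 hw₁ (withId_apart hne.symm)
  have hv : P.d v₁ v = 1 := by rw [P.comm]; exact hv₁
  obtain ⟨a₀, ha₀, Na₀⟩ := (N2.symm.opp hv).desc
  refine Good.all (Frame.good ⟨hv₁, hw₁, N0, N2, ha₀, ha₁, Na₀.symm.1, Na₁.symm.1,
    withId_regular fun e => ?_, withId_regular fun e => ?_⟩) v
  · have h1 : P.d (f v₁) (f w₁) = n + 3 := N2.2.1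
    have h2 : P.d (f a₀) (f w₁) = n + 1 := Na₀.symm.2.1
    rw [e] at h1; omega
  · have h1 : P.d (f v) (f w₀) = n + 3 := N0.2.1
    have h2 : P.d (f a₁) (f w₀) = n + 1 := Na₁.symm.2.1
    rw [e] at h1; omega

/-- A surjective endomorphism which is not injective collapses a panel of each type. -/
theorem exists_collapse (hf : P.IsHom P f) (hs : Function.Surjective f)
    (hni : ¬ Function.Injective f) (o : W) :
    ∃ u x₁ x₂, Even (P.d o u) ∧ P.d u x₁ = 1 ∧ P.d u x₂ = 1 ∧ f x₁ = f x₂ ∧ x₁ ≠ x₂ := by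
  by_contra! hc
  refine hni fun x y hxy => ?_
  -- For the pair of `f` and the identity, `Refines` means that `f` is injective on the panel.
  have hR := refines_of_even (T := withId hf hs) withId_good (o := o)
    fun v hv a b ha hb e => hc v a b hv ha hb e
  exact eq_of_refines (T := withId hf hs) withId_good hR hxy

end HomPair

/-! ### Limits of vertices and chambers -/

namespace MGon

section Limits

variable {V : Type*} [TopologicalSpace V] {m : ℕ} {Δ : MGon V m} {ι : Type*}

theorem IsCompactPolygon.isClosed_adj (h : Δ.IsCompactPolygon) :
    IsClosed {p : V × V | Δ.graph.Adj p.1 p.2} := by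
  have e : {p : V × V | Δ.graph.Adj p.1 p.2} = Δ.chamberSet ∪ Prod.swap ⁻¹' Δ.chamberSet := by
    ext ⟨a, b⟩
    simp only [chamberSet, Set.mem_ofPred_eq, Set.mem_union, Set.mem_preimage, Prod.fst_swap,
      Prod.snd_swap]
    constructor
    · intro hab
      have := Δ.type.valid hab
      by_cases ha : Δ.type a = false
      · exact .inl ⟨hab, ha⟩
      · exact .inr ⟨hab.symm, by simp_all⟩
    · rintro (h | h)
      · exact h.1
      · exact h.1.symm
  rw [e]
  exact h.isClosed_chamberSet.union (h.isClosed_chamberSet.preimage continuous_swap)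

theorem IsCompactPolygon.adj_of_tendsto (h : Δ.IsCompactPolygon) {l : Filter ι} [l.NeBot]
    {a b : ι → V} {a₀ b₀ : V} (ha : Tendsto a l (𝓝 a₀)) (hb : Tendsto b l (𝓝 b₀))
    (hab : ∀ᶠ i in l, Δ.graph.Adj (a i) (b i)) : Δ.graph.Adj a₀ b₀ :=
  h.isClosed_adj.mem_of_tendsto (ha.prodMk_nhds hb) hab

theorem IsCompactPolygon.exists_tendsto (h : Δ.IsCompactPolygon) (U : Ultrafilter ι) (a : ι → V) :
    ∃ a₀, Tendsto a U (𝓝 a₀) := by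
  have := h.compact
  exact ⟨(U.map a).lim, (U.map a).le_nhds_lim⟩

/-- Compactness provides limits of the intermediate vertices of geodesics, and adjacency is closed,
so distances do not increase in the limit. -/
theorem IsCompactPolygon.dist_le_of_tendsto (h : Δ.IsCompactPolygon) (U : Ultrafilter ι) (k : ℕ) :
    ∀ {a b : ι → V} {a₀ b₀ : V}, Tendsto a U (𝓝 a₀) → Tendsto b U (𝓝 b₀) →
      (∀ᶠ i in (U : Filter ι), Δ.graph.dist (a i) (b i) ≤ k) → Δ.graph.dist a₀ b₀ ≤ k := by
  have := h.metrizable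
  induction k with
  | zero =>
    intro a b a₀ b₀ ha hb hab
    have hab' : a =ᶠ[U] b := hab.mono fun i hi => Δ.connected.dist_eq_zero_iff.1 (by omega)
    rw [tendsto_nhds_unique (ha.congr' hab') hb]
    simp
  | succ k ih =>
    intro a b a₀ b₀ ha hb hab
    have hex : ∀ i, ∃ z, (z = b i ∨ Δ.graph.Adj (b i) z) ∧
        (Δ.graph.dist (a i) (b i) ≤ k + 1 → Δ.graph.dist (a i) z ≤ k) := by
      intro i
      rcases hd : Δ.graph.dist (a i) (b i) with _ | j
      · exact ⟨b i, .inl rfl, fun _ => by omega⟩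
      · obtain ⟨z, hz, hzj⟩ := Δ.dist_desc _ _ _ hd
        exact ⟨z, .inr hz, fun _ => by omega⟩
    choose z hz hzk using hex
    obtain ⟨z₀, hz₀⟩ := h.exists_tendsto U z
    have h1 := ih ha hz₀ (hab.mono hzk)
    have h2 : (∀ᶠ i in (U : Filter ι), z i = b i) ∨
        ∀ᶠ i in (U : Filter ι), Δ.graph.Adj (b i) (z i) :=
      Ultrafilter.eventually_or.1 (Eventually.of_forall hz)
    rcases h2 with h2 | h2
    · rw [tendsto_nhds_unique (hz₀.congr' h2) hb] at h1
      omega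
    · have h3 := SimpleGraph.dist_eq_one_iff_adj.2 (h.adj_of_tendsto hb hz₀ h2)
      have h4 := Δ.connected.dist_triangle (u := a₀) (v := z₀) (w := b₀)
      rw [SimpleGraph.dist_comm] at h3
      omega

/-- Otherwise chambers at vertices of the wrong type would converge to an edge ordered against its
types, although `chamberSet` is closed. -/
theorem IsCompactPolygon.eventually_type (h : Δ.IsCompactPolygon) (hn : ∀ v, ∃ z, Δ.graph.Adj v z)
    {l : Filter ι} {a : ι → V} {a₀ : V} (ha : Tendsto a l (𝓝 a₀)) :
    ∀ᶠ i in l, Δ.type (a i) = Δ.type a₀ := by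
  by_contra hc
  have hc : ∃ᶠ i in l, ¬ Δ.type (a i) = Δ.type a₀ := not_eventually.1 hc
  have : (l ⊓ 𝓟 {i | ¬ Δ.type (a i) = Δ.type a₀}).NeBot := frequently_mem_iff_neBot.1 hc
  obtain ⟨U, hU⟩ := Ultrafilter.exists_le (l ⊓ 𝓟 {i | ¬ Δ.type (a i) = Δ.type a₀})
  have ha' : Tendsto a U (𝓝 a₀) := ha.mono_left (hU.trans inf_le_left)
  have hU' : ∀ᶠ i in (U : Filter ι), ¬ Δ.type (a i) = Δ.type a₀ :=
    (hU.trans inf_le_right) (mem_principal_self _)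
  choose z hz using fun i => hn (a i)
  obtain ⟨z₀, hz₀⟩ := h.exists_tendsto U z
  cases e : Δ.type a₀
  · have h1 : (z₀, a₀) ∈ Δ.chamberSet :=
      h.isClosed_chamberSet.mem_of_tendsto (hz₀.prodMk_nhds ha') <| hU'.mono fun i hi =>
        ⟨(hz i).symm, by rw [Δ.type_ne_of_adj (hz i)]; revert hi; rw [e]; simp⟩
    have h2 := Δ.type_ne_of_adj h1.1
    rw [h1.2, e] at h2
    exact absurd h2 (by decide)
  · have h1 : (a₀, z₀) ∈ Δ.chamberSet :=
      h.isClosed_chamberSet.mem_of_tendsto (ha'.prodMk_nhds hz₀) <| hU'.mono fun i hi =>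
        ⟨hz i, by revert hi; rw [e]; simp⟩
    rw [h1.2] at e
    exact absurd e (by decide)

theorem IsCompactPolygon.tendsto_chamberOf (h : Δ.IsCompactPolygon)
    (hn : ∀ v, ∃ z, Δ.graph.Adj v z) {l : Filter ι} {a b : ι → V} {a₀ b₀ : V}
    (hab : ∀ i, Δ.graph.Adj (a i) (b i)) (hab₀ : Δ.graph.Adj a₀ b₀)
    (ha : Tendsto a l (𝓝 a₀)) (hb : Tendsto b l (𝓝 b₀)) :
    Tendsto (fun i => Δ.chamberOf (a i) (b i) (hab i)) l (𝓝 (Δ.chamberOf a₀ b₀ hab₀)) := by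
  have ht := h.eventually_type hn ha
  rw [tendsto_subtype_rng]
  by_cases e : Δ.type a₀ = false
  · rw [Δ.chamberOf_of_false hab₀ e]
    refine (ha.prodMk_nhds hb).congr' (ht.mono fun i hi => ?_)
    beta_reduce
    rw [Δ.chamberOf_of_false (hab i) (hi.trans e)]
  · have e' : Δ.type b₀ = false := by
      rw [Δ.type_ne_of_adj hab₀]; simpa using e
    rw [Δ.chamberOf_comm hab₀, Δ.chamberOf_of_false hab₀.symm e']
    refine (hb.prodMk_nhds ha).congr' (ht.mono fun i hi => ?_)
    have e2 : Δ.type (b i) = false := by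
      rw [Δ.type_ne_of_adj (hab i), hi]; simpa using e
    beta_reduce
    rw [Δ.chamberOf_comm (hab i), Δ.chamberOf_of_false (hab i).symm e2]

end Limits

variable {V : Type*} [TopologicalSpace V] {n : ℕ} {Δ : MGon V (n + 3)}

theorem IsCompactPolygon.isClosed_neighborSet (h : Δ.IsCompactPolygon) (w : V) :
    IsClosed (Δ.graph.neighborSet w) :=
  h.isClosed_adj.preimage (f := fun z => (w, z)) (by fun_prop)

/-- Perspectivities between opposite vertices are continuous. -/
theorem IsCompactPolygon.eventually_persp (h : Δ.IsCompactPolygon) (ht : Δ.IsThick) {x w p y : V}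
    (hxw : (Δ.polygon ht).d x w = n + 3) (hp : (Δ.polygon ht).d x p = 1)
    (hy : (Δ.polygon ht).d w y = 1) (hpy : (Δ.polygon ht).d p y = n + 1) {U : Set V}
    (hU : U ∈ 𝓝 p) : ∀ᶠ z in 𝓝[Δ.graph.neighborSet w] y, ∀ q, (Δ.polygon ht).d x q = 1 →
      (Δ.polygon ht).d q z = n + 1 → q ∈ U := by
  set P := Δ.polygon ht with hP
  obtain ⟨O, hOU, hO, hpO⟩ := mem_nhds_iff.1 hU
  by_contra hc
  have hc : ∃ᶠ z in 𝓝[Δ.graph.neighborSet w] y, ¬ ∀ q, P.d x q = 1 → P.d q z = n + 1 → q ∈ U :=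
    not_eventually.1 hc
  set B := {z | ¬ ∀ q, P.d x q = 1 → P.d q z = n + 1 → q ∈ U} with hB
  have : (𝓝[Δ.graph.neighborSet w] y ⊓ 𝓟 B).NeBot := frequently_mem_iff_neBot.1 hc
  obtain ⟨F, hF⟩ := Ultrafilter.exists_le (𝓝[Δ.graph.neighborSet w] y ⊓ 𝓟 B)
  have hFB : ∀ᶠ z in (F : Filter V), z ∈ B := (hF.trans inf_le_right) (mem_principal_self _)
  have hFy : Tendsto id (F : Filter V) (𝓝 y) := (hF.trans inf_le_left).trans nhdsWithin_le_nhds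
  have hex : ∀ z, ∃ q, z ∈ B → P.d x q = 1 ∧ P.d q z = n + 1 ∧ q ∉ U := by
    intro z
    by_cases hz : z ∈ B
    · have hz' := hz
      simp only [hB, Set.mem_ofPred_eq] at hz'
      push Not at hz'
      obtain ⟨q, h1, h2, h3⟩ := hz'
      exact ⟨q, fun _ => ⟨h1, h2, h3⟩⟩
    · exact ⟨z, fun h => absurd h hz⟩
  choose q hq using hex
  -- The limit `q₀` of the projections is a neighbour of `x` within `n + 1` of `y`, hence equal to
  -- `p`, yet it lies outside `O`.
  obtain ⟨q₀, hq₀⟩ := h.exists_tendsto F q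
  have h1 : P.d x q₀ = 1 := SimpleGraph.dist_eq_one_iff_adj.2 <|
    h.adj_of_tendsto tendsto_const_nhds hq₀ <|
      hFB.mono fun z hz => SimpleGraph.dist_eq_one_iff_adj.1 (hq z hz).1
  have h2 : P.d q₀ y ≤ n + 1 := h.dist_le_of_tendsto F _ hq₀ hFy <|
    hFB.mono fun z hz => (hq z hz).2.1.le
  have h3 : q₀ ∉ O := by
    have : q₀ ∈ Oᶜ := hO.isClosed_compl.mem_of_tendsto hq₀ <|
      hFB.mono fun z hz hzO => (hq z hz).2.2 (hOU hzO)
    exact this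
  have h4 := P.step x w y hy
  have h5 := P.step y x q₀ h1
  have h6 := P.d_le x y
  have h7 := P.comm x y
  have h8 := P.comm q₀ y
  refine h3 ?_
  rwa [P.uniq y x q₀ p (n + 1) (by omega) (by omega) h1 hp (by omega) (by rw [P.comm]; exact hpy)]

/-! ### Injectivity of continuous surjective endomorphisms -/

open HomPair

/-- A continuous surjective endomorphism of a compact polygon is injective. -/
theorem IsCompactPolygon.injective (h : Δ.IsCompactPolygon) (ht : Δ.IsThick) {f : V → V}
    (hf : (Δ.polygon ht).IsHom (Δ.polygon ht) f) (hs : Function.Surjective f)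
    (hc : Continuous f) : Function.Injective f := by
  have := h.metrizable
  have := h.compact
  set P := Δ.polygon ht with hP
  have hadj : ∀ x z, z ∈ Δ.graph.neighborSet x ↔ P.d x z = 1 := fun x z =>
    SimpleGraph.dist_eq_one_iff_adj.symm
  by_contra hni
  let T := withId hf hs
  have hG : ∀ x, T.Good x := withId_good
  -- Local constancy of `f` on panels is invariant, since perspectivities are continuous and
  -- compatible with `f`.
  let F : V → V → Prop := fun x a => ∀ᶠ z in 𝓝[Δ.graph.neighborSet x] a, f z = f a
  have hF : T.Inv fun x a _ => F x a := by
    intro x w a _ a' _ hN ha _ ha' _ haa _ hFa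
    change ∀ᶠ z in 𝓝[Δ.graph.neighborSet x] a, f z = f a at hFa
    change ∀ᶠ z in 𝓝[Δ.graph.neighborSet w] a', f z = f a'
    rw [eventually_nhdsWithin_iff] at hFa
    have h1 := h.eventually_persp ht hN.1 ha ha' haa hFa
    filter_upwards [h1, self_mem_nhdsWithin] with z hz hzw
    rw [hadj] at hzw
    obtain ⟨q, hq, hqz⟩ := hN.symm.persp hzw
    have h2 := hz q hq hqz.symm.1
    rw [hadj] at h2
    exact (hN.persp_σ hq ha hzw ha' hqz.symm.1 haa).1 (h2 hq)
  -- among the vertices of each type, there is one whose panel has an open fibre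
  have main : ∀ w, ∃ w' y, Even (P.d w w') ∧ P.d w' y = 1 ∧ F w' y := by
    intro o
    -- The vertex `w` found below is at distance `n + 2` from the collapsed panel, whose type is
    -- chosen here so that `w` gets the type of `o`.
    obtain ⟨o', ho'⟩ : ∃ o', Even (P.d o o' + (n + 2)) := by
      obtain ⟨z, hz, -⟩ := P.thick o o o
      by_cases hn : Even n
      · refine ⟨o, ?_⟩
        rw [P.d_self]
        exact (by simpa using hn.add even_two)
      · refine ⟨z, ?_⟩
        rw [hz, show 1 + (n + 2) = n + 1 + 2 by ring]
        exact (Nat.even_add_one.2 hn).add even_two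
    obtain ⟨u, x₁, x₂, hu, hx₁, hx₂, hfx, hne⟩ := exists_collapse hf hs hni o'
    obtain ⟨W, hW, -⟩ := (hG u).opp
    obtain ⟨w, hw, hxw⟩ := (hW.symm.opp hx₂).symm.desc
    have huw : T.N u w (n + 2) := hW.opp hw
    have hpar : ∀ x y, Even (P.d x y) ↔ Δ.type x = Δ.type y := Δ.dist_parity
    have how : Even (P.d o w) := by
      have h1 := hpar o o'
      have h2 := hpar o' u
      have h3 := hpar u w
      have h4 := hpar o w
      rw [huw.1] at h3
      rw [Nat.even_add] at ho'
      rw [h4]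
      rw [h1, h3] at ho'
      rw [h2] at hu
      revert hu ho'
      cases Δ.type o <;> cases Δ.type o' <;> cases Δ.type u <;> cases Δ.type w <;> simp
    -- The collapse makes `x₁` and `w` opposite while their images are not.
    have hx₁w : P.d x₁ w = n + 3 := by
      have h1 := P.step w u x₁ hx₁
      have h2 := P.comm w u
      have h3 := P.comm w x₁
      have h4 := huw.1
      have h5 : P.d w x₁ ≠ n + 1 := fun e => hne <|
        P.uniq w u _ _ (n + 1) (by omega) (by omega) hx₁ hx₂ e hxw.symm.1
      omega
    have hfxw : P.d (f x₁) (f w) = n + 1 := by rw [hfx]; exact hxw.2.1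
    obtain ⟨c, hcw, hcx⟩ := P.desc _ _ _ hfxw
    -- Unless `f x` is the neighbour `b` of `f x₁` facing `f w`, the projection of `x` to `w` is
    -- sent to the fixed vertex `c`. So `f` is constant on an open piece of the panel of `w`.
    have claim : ∀ x x', P.d x₁ x = 1 → P.d w x' = 1 → P.d x x' = n + 1 →
        P.d (f x) (f w) = n + 2 → f x' = c := by
      intro x x' hx hx' hxx' hd
      have h1 := hf _ _ hx
      have h2 := P.step (f x) _ _ (hf _ _ hx')
      obtain ⟨j, hj⟩ := hf.d_le x x'
      have h3 := P.step (f x) _ _ hcw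
      have h4 := P.step c _ _ h1
      have h5 := P.comm c (f x₁)
      have h6 := P.comm c (f x)
      exact P.uniq (f x) (f w) _ _ (n + 1) hd (by omega) (hf _ _ hx') hcw (by omega) (by omega)
    obtain ⟨b, hb⟩ : ∃ b, ∀ x, P.d x₁ x = 1 → f x ≠ b → P.d (f x) (f w) = n + 2 := by
      obtain ⟨b, hb1, hb⟩ := P.desc (f w) (f x₁) n (by rw [P.comm]; exact hfxw)
      refine ⟨b, fun x hx hxb => ?_⟩
      have h1 := P.step (f w) _ _ (hf _ _ hx)
      have h2 := P.comm (f w) (f x₁)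
      have h3 := P.comm (f w) (f x)
      have h4 : P.d (f w) (f x) ≠ n := fun e => hxb <|
        P.uniq (f w) (f x₁) _ _ n (by omega) (by omega) (hf _ _ hx) hb1 e hb
      omega
    obtain ⟨x, hx, hxb, -⟩ := hf.exists_adj_ne hs x₁ b b
    have hopen : {z | f z ≠ b} ∈ 𝓝 x := (isOpen_ne.preimage hc).mem_nhds hxb
    obtain ⟨x', hx', hxx'⟩ : ∃ x', P.d w x' = 1 ∧ P.d x x' = n + 1 := by
      have h1 := P.step w x₁ x hx
      have h2 := P.comm w x₁
      have h3 := P.d_le w x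
      have h4 := P.comm w x
      exact P.desc x w (n + 1) (by omega)
    refine ⟨w, x', how, hx', ?_⟩
    have ev := h.eventually_persp ht hx₁w hx hx' hxx' hopen
    filter_upwards [ev, self_mem_nhdsWithin] with z hz hzw
    rw [hadj] at hzw
    obtain ⟨q, hq, hqz⟩ : ∃ q, P.d x₁ q = 1 ∧ P.d z q = n + 1 := by
      have h1 := P.step x₁ w z hzw
      have h2 := P.d_le x₁ z
      have h4 := P.comm x₁ z
      exact P.desc z x₁ (n + 1) (by omega)
    have hqz' : P.d q z = n + 1 := by rw [P.comm]; exact hqz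
    rw [claim q z hq hzw hqz' (hb q hq (hz q hq hqz')),
      claim x x' hx hx' hxx' (hb x hx hxb)]
  have hall : ∀ w y, P.d w y = 1 → F w y := by
    intro w y hy
    obtain ⟨w', y', hw', hy', hFy⟩ := main w
    exact trans_even hF hG hy' hFy (by rw [P.comm]; exact hw') hy
  -- A locally constant map on a compact panel has finite image, and by `exists_lift` this image is
  -- a full panel.
  have hfin : ∀ w, (Δ.graph.neighborSet w).Finite := by
    intro w
    obtain ⟨w, rfl⟩ := hs w
    obtain ⟨t, -, hts⟩ := (h.isClosed_neighborSet w).isCompact.elim_nhdsWithin_subcover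
      (fun y => {z | f z = f y}) fun y hy => hall w y ((hadj _ _).1 hy)
    refine (t.finite_toSet.image f).subset fun b hb => ?_
    obtain ⟨y, hy, rfl⟩ := hf.exists_lift hs ((hadj _ _).1 hb)
    have := hts ((hadj _ _).2 hy)
    simp only [Set.mem_iUnion, Set.mem_ofPred_eq] at this
    obtain ⟨z, hz, e⟩ := this
    exact ⟨z, hz, e.symm⟩
  have hball : ∀ o k, {x | P.d o x ≤ k}.Finite := by
    intro o k
    induction k with
    | zero => exact (Set.finite_singleton o).subset fun x hx =>
        (P.eq_of_d _ _ (Nat.le_zero.1 hx)).symm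
    | succ k ih =>
      refine (ih.union (ih.biUnion fun z _ => hfin z)).subset fun x hx => ?_
      rcases Nat.lt_or_ge (P.d o x) (k + 1) with hlt | hge
      · exact .inl (Nat.lt_succ_iff.1 hlt)
      · obtain ⟨z, hz, hzk⟩ := P.desc o x k (le_antisymm hx hge)
        refine .inr (Set.mem_biUnion (x := z) hzk.le ((hadj _ _).2 ?_))
        rw [P.comm]; exact hz
  have : Finite V := by
    rcases isEmpty_or_nonempty V with _ | ⟨⟨o⟩⟩
    · infer_instance
    · exact Set.finite_univ_iff.1 ((hball o (n + 3)).subset fun x _ => P.d_le o x)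
  exact hni (Finite.injective_iff_surjective.2 hs)

end MGon

/-! ### Continuous convergence and ultrapowers -/

theorem Ultrafilter.exists_eventually_eq_of_le {ι : Type*} (U : Ultrafilter ι) {f : ι → ℕ} {m : ℕ}
    (h : ∀ᶠ i in (U : Filter ι), f i ≤ m) : ∃ k, ∀ᶠ i in (U : Filter ι), f i = k := by
  induction m with
  | zero => exact ⟨0, h.mono fun i hi => by omega⟩
  | succ m ih =>
    have : ∀ᶠ i in (U : Filter ι), f i ≤ m ∨ f i = m + 1 := h.mono fun i hi => by omega
    rcases Ultrafilter.eventually_or.1 this with h1 | h1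
    · exact ih h1
    · exact ⟨_, h1⟩

/-- If maps converge continuously along an ultrafilter, then the limit is continuous. -/
theorem continuous_of_tendsto_ultrafilter {ι X Y : Type*} [TopologicalSpace X]
    [FirstCountableTopology X] [TopologicalSpace Y] [RegularSpace Y] (U : Ultrafilter ι)
    {φ : ι → X → Y} (hφ : ∀ i, Continuous (φ i)) {τ : X → Y}
    (h : ∀ (x : ι → X) (a : X), Tendsto x U (𝓝 a) →
      Tendsto (fun i => φ i (x i)) U (𝓝 (τ a))) : Continuous τ := by
  rw [continuous_iff_continuousAt]
  intro a
  obtain ⟨B, hB⟩ := (𝓝 a).exists_antitone_basis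
  refine (closed_nhds_basis (τ a)).tendsto_right_iff.2 fun O ⟨hO, hOc⟩ => ?_
  by_cases hk : ∃ k, ∀ᶠ i in (U : Filter ι), Set.MapsTo (φ i) (B k) O
  · obtain ⟨k, hk⟩ := hk
    filter_upwards [hB.1.mem_of_mem (i := k) trivial] with a' ha'
    exact hOc.mem_of_tendsto (h (fun _ => a') a' tendsto_const_nhds) (hk.mono fun i hi => hi ha')
  -- Diagonal argument: `x i` is taken in the last, hence smallest, `B K` before the first one that
  -- `φ i` maps into `O`, and escapes from `O`. Since no fixed `B k` is mapped into `O` for most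
  -- `i`, these points tend to `a`.
  · push Not at hk
    have hk' : ∀ k, ∀ᶠ i in (U : Filter ι), ¬ Set.MapsTo (φ i) (B k) O := hk
    have hgood : ∀ᶠ i in (U : Filter ι), ∃ k, Set.MapsTo (φ i) (B k) O := by
      have h1 := (h (fun _ => a) a tendsto_const_nhds).eventually
        (interior_mem_nhds.2 hO)
      refine h1.mono fun i hi => ?_
      have h2 : φ i ⁻¹' O ∈ 𝓝 a := (hφ i).continuousAt (mem_interior_iff_mem_nhds.1 hi)
      obtain ⟨k, -, hk⟩ := hB.1.mem_iff.1 h2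
      exact ⟨k, hk⟩
    have hex : ∀ i, ∃ y, (∃ k, Set.MapsTo (φ i) (B k) O) → ¬ Set.MapsTo (φ i) (B 0) O →
        (∀ k, ¬ Set.MapsTo (φ i) (B k) O → y ∈ B k) ∧ φ i y ∉ O := by
      classical
      intro i
      by_cases h1 : ∃ k, Set.MapsTo (φ i) (B k) O
      · by_cases h2 : Set.MapsTo (φ i) (B 0) O
        · exact ⟨a, fun _ h => absurd h2 h⟩
        · have h3 : Nat.find h1 ≠ 0 := fun e => h2 (e ▸ Nat.find_spec h1)
          obtain ⟨K, hK⟩ := Nat.exists_eq_succ_of_ne_zero h3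
          have h4 : ¬ Set.MapsTo (φ i) (B K) O := Nat.find_min h1 (by omega)
          unfold Set.MapsTo at h4
          push Not at h4
          obtain ⟨y, hy, hyO⟩ := h4
          refine ⟨y, fun _ _ => ⟨fun k hk => ?_, hyO⟩⟩
          have : k ≤ K := by
            by_contra hlt
            refine hk ((Nat.find_spec h1).mono_left (hB.2 ?_))
            omega
          exact hB.2 this hy
      · exact ⟨a, fun h => absurd h h1⟩
    choose x hx using hex
    have hxa : Tendsto x U (𝓝 a) := by
      refine hB.1.tendsto_right_iff.2 fun k _ => ?_
      filter_upwards [hgood, hk' 0, hk' k] with i h1 h2 h3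
      exact (hx i h1 h2).1 k h3
    have h1 := (h x a hxa).eventually hO
    have h2 : ∀ᶠ i in (U : Filter ι), φ i (x i) ∉ O := by
      filter_upwards [hgood, hk' 0] with i h1 h2
      exact (hx i h1 h2).2
    obtain ⟨i, hi, hi'⟩ := (h1.and h2).exists
    exact absurd hi hi'

namespace ThickPolygon

variable {V ι : Type*} {m : ℕ} (P : ThickPolygon V m) (U : Ultrafilter ι)

/-- Distances are bounded, so along an ultrafilter they are eventually constant; the ultrapower
needs no nonstandard distances. -/
theorem exists_germ_d (x y : Germ (U : Filter ι) V) :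
    ∃ k : ℕ, Germ.map₂ P.d x y = (k : Germ (U : Filter ι) ℕ) := by
  induction x using Germ.inductionOn with | _ a
  induction y using Germ.inductionOn with | _ b
  obtain ⟨k, hk⟩ := U.exists_eventually_eq_of_le (f := fun i => P.d (a i) (b i))
    (Eventually.of_forall fun i => P.d_le _ _)
  exact ⟨k, Germ.coe_eq.2 hk⟩

/-- The distance function of an ultrapower. -/
noncomputable def germD (x y : Germ (U : Filter ι) V) : ℕ := (P.exists_germ_d U x y).choose

theorem germD_eq_iff (a b : ι → V) (k : ℕ) :
    P.germD U a b = k ↔ ∀ᶠ i in (U : Filter ι), P.d (a i) (b i) = k := by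
  have h : ∀ᶠ i in (U : Filter ι), P.d (a i) (b i) = P.germD U a b :=
    Germ.coe_eq.1 (P.exists_germ_d U a b).choose_spec
  constructor
  · rintro rfl
    exact h
  · intro h'
    obtain ⟨i, hi, hi'⟩ := (h.and h').exists
    omega

theorem eventually_germD (a b : ι → V) :
    ∀ᶠ i in (U : Filter ι), P.d (a i) (b i) = P.germD U a b := (P.germD_eq_iff U a b _).1 rfl

/-- Ultrapowers of thick polygons are thick polygons. -/
noncomputable def ultrapower : ThickPolygon (Germ (U : Filter ι) V) m where
  d := P.germD U
  d_le x y := by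
    induction x using Germ.inductionOn with | _ a
    induction y using Germ.inductionOn with | _ b
    obtain ⟨i, hi⟩ := (P.eventually_germD U a b).exists
    rw [← hi]
    exact P.d_le _ _
  comm x y := by
    induction x using Germ.inductionOn with | _ a
    induction y using Germ.inductionOn with | _ b
    rw [germD_eq_iff]
    exact (P.eventually_germD U b a).mono fun i hi => by rw [P.comm]; exact hi
  eq_of_d x y h := by
    induction x using Germ.inductionOn with | _ a
    induction y using Germ.inductionOn with | _ b
    rw [germD_eq_iff] at h
    exact Germ.coe_eq.2 (h.mono fun i hi => P.eq_of_d _ _ hi)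
  d_self x := by
    induction x using Germ.inductionOn with | _ a
    rw [germD_eq_iff]
    exact Eventually.of_forall fun i => P.d_self _
  step x y z h := by
    induction x using Germ.inductionOn with | _ a
    induction y using Germ.inductionOn with | _ b
    induction z using Germ.inductionOn with | _ c
    rw [germD_eq_iff] at h
    obtain ⟨i, h1, h2, h3⟩ :=
      (h.and ((P.eventually_germD U a b).and (P.eventually_germD U a c))).exists
    rw [← h2, ← h3]
    exact P.step _ _ _ h1
  desc x y k h := by
    induction x using Germ.inductionOn with | _ a
    induction y using Germ.inductionOn with | _ b
    rw [germD_eq_iff] at h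
    have hex : ∀ i, ∃ z, P.d (a i) (b i) = k + 1 → P.d (b i) z = 1 ∧ P.d (a i) z = k := by
      intro i
      by_cases hi : P.d (a i) (b i) = k + 1
      · obtain ⟨z, hz⟩ := P.desc _ _ _ hi
        exact ⟨z, fun _ => hz⟩
      · exact ⟨a i, fun h => absurd h hi⟩
    choose z hz using hex
    exact ⟨(z : Germ (U : Filter ι) V), (P.germD_eq_iff U _ _ _).2 (h.mono fun i hi => (hz i hi).1),
      (P.germD_eq_iff U _ _ _).2 (h.mono fun i hi => (hz i hi).2)⟩
  uniq x y z z' k h hk hz hz' hxz hxz' := by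
    induction x using Germ.inductionOn with | _ a
    induction y using Germ.inductionOn with | _ b
    induction z using Germ.inductionOn with | _ c
    induction z' using Germ.inductionOn with | _ c'
    rw [germD_eq_iff] at h hz hz' hxz hxz'
    refine Germ.coe_eq.2 ?_
    filter_upwards [h, hz, hz', hxz, hxz'] with i h1 h2 h3 h4 h5
    exact P.uniq _ _ _ _ k h1 hk h2 h3 h4 h5
  thick y a b := by
    induction y using Germ.inductionOn with | _ y
    induction a using Germ.inductionOn with | _ a
    induction b using Germ.inductionOn with | _ b
    choose z h1 h2 h3 using fun i => P.thick (y i) (a i) (b i)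
    refine ⟨(z : Germ (U : Filter ι) V), (P.germD_eq_iff U _ _ _).2 (Eventually.of_forall h1),
      fun e => ?_, fun e => ?_⟩
    · obtain ⟨i, hi⟩ := (Germ.coe_eq.1 e).exists
      exact h2 i hi
    · obtain ⟨i, hi⟩ := (Germ.coe_eq.1 e).exists
      exact h3 i hi

theorem ultrapower_d_eq_iff {a b : ι → V} {k : ℕ} :
    (P.ultrapower U).d a b = k ↔ ∀ᶠ i in (U : Filter ι), P.d (a i) (b i) = k :=
  P.germD_eq_iff U a b k

theorem ultrapower_d_const (x y : V) :
    (P.ultrapower U).d ((fun _ => x : ι → V) : Germ (U : Filter ι) V)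
      ((fun _ => y : ι → V) : Germ (U : Filter ι) V) = P.d x y :=
  (P.ultrapower_d_eq_iff U).2 (Eventually.of_forall fun _ => rfl)

end ThickPolygon

namespace HomPair

variable {W W' : Type*} {n : ℕ} {P : ThickPolygon W (n + 3)} {P' : ThickPolygon W' (n + 3)}
  {T : HomPair P P'}

/-- The factor is a homomorphism because edges lift through σ. -/
theorem exists_factor (h : ∀ x y, T.σ x = T.σ y → T.ψ x = T.ψ y) :
    ∃ τ : W' → W', P'.IsHom P' τ ∧ Function.Surjective τ ∧ ∀ x, τ (T.σ x) = T.ψ x := by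
  choose s hs using T.surjσ
  have hτ : ∀ x, T.ψ (s (T.σ x)) = T.ψ x := fun x => h _ _ (hs _)
  refine ⟨fun a => T.ψ (s a), fun a b hab => ?_, fun b => ?_, hτ⟩
  · obtain ⟨y, hy, rfl⟩ := T.homσ.exists_lift T.surjσ (x := s a) (b := b) (by rw [hs]; exact hab)
    change P'.d (T.ψ (s a)) (T.ψ (s (T.σ y))) = 1
    rw [hτ]
    exact T.homψ _ _ hy
  · obtain ⟨x, rfl⟩ := T.surjψ b
    exact ⟨T.σ x, hτ x⟩

end HomPair

/-! ### Limits of topological automorphisms -/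

namespace MGon

section TopAut

variable {V : Type*} [TopologicalSpace V] {m : ℕ} {Δ : MGon V m}

theorem IsCompactPolygon.compactSpace_chamber (h : Δ.IsCompactPolygon) : CompactSpace Δ.Chamber := by
  have := h.compact
  exact isCompact_iff_compactSpace.1 h.isClosed_chamberSet.isCompact

theorem IsCompactPolygon.continuous_chamberMap (h : Δ.IsCompactPolygon)
    (hn : ∀ v, ∃ z, Δ.graph.Adj v z) {g : Δ.graph ≃g Δ.graph} (hg : Continuous g) :
    Continuous (Δ.chamberMap g) := by
  rw [continuous_iff_continuousAt]
  intro C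
  exact h.tendsto_chamberOf hn (fun D : Δ.Chamber => g.map_adj_iff.2 D.2.1) (g.map_adj_iff.2 C.2.1)
    (hg.comp (continuous_fst.comp continuous_subtype_val)).continuousAt
    (hg.comp (continuous_snd.comp continuous_subtype_val)).continuousAt

/-- Vertices and chambers form compact Hausdorff spaces, where continuous bijections are
homeomorphisms. -/
theorem IsCompactPolygon.mem_topAut (h : Δ.IsCompactPolygon) (hn : ∀ v, ∃ z, Δ.graph.Adj v z)
    {g : Δ.graph ≃g Δ.graph} (hg : Continuous g) : g ∈ Δ.topAut := by
  have := h.compact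
  have := h.metrizable
  have := h.compactSpace_chamber
  refine ⟨isHomeomorph_iff_continuous_bijective.2 ⟨hg, g.bijective⟩,
    isHomeomorph_iff_continuous_bijective.2 ⟨h.continuous_chamberMap hn hg, ?_⟩⟩
  refine Function.bijective_iff_has_inverse.2 ⟨Δ.chamberMap g⁻¹, fun C => ?_, fun C => ?_⟩
  · exact congrFun (by rw [← Δ.chamberMap_mul, inv_mul_cancel, Δ.chamberMap_one] :
      Δ.chamberMap g⁻¹ ∘ Δ.chamberMap g = id) C
  · exact congrFun (by rw [← Δ.chamberMap_mul, mul_inv_cancel, Δ.chamberMap_one] :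
      Δ.chamberMap g ∘ Δ.chamberMap g⁻¹ = id) C

variable {ι : Type*}

variable (Δ) in
/-- The automorphisms `φ i` converge continuously to `f` on the vertices. -/
def ConvergesTo (U : Ultrafilter ι) (φ : ι → Δ.topAut) (f : V → V) : Prop :=
  ∀ (x : ι → V) (a : V), Tendsto x U (𝓝 a) → Tendsto (fun i => (φ i).1 (x i)) U (𝓝 (f a))

theorem ConvergesTo.tendsto_chamberMap {U : Ultrafilter ι} {φ : ι → Δ.topAut} {g : Δ.topAut}
    (h : Δ.ConvergesTo U φ g.1) (hΔ : Δ.IsCompactPolygon) (hn : ∀ v, ∃ z, Δ.graph.Adj v z)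
    {X : ι → Δ.Chamber} {C : Δ.Chamber} (hX : Tendsto X U (𝓝 C)) :
    Tendsto (fun i => Δ.chamberMap (φ i).1 (X i)) U (𝓝 (Δ.chamberMap g.1 C)) :=
  hΔ.tendsto_chamberOf hn (fun i => (φ i).1.map_adj_iff.2 (X i).2.1) _
    (h _ _ (((continuous_fst.comp continuous_subtype_val).tendsto C).comp hX))
    (h _ _ (((continuous_snd.comp continuous_subtype_val).tendsto C).comp hX))

/-- If a compact `K` kept leaving the open `O`, points of `K` witnessing this would have a limit in
`K`, against continuous convergence. -/
theorem ConvergesTo.tendsto {U : Ultrafilter ι} {φ : ι → Δ.topAut} {g : Δ.topAut}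
    (h : Δ.ConvergesTo U φ g.1) (hΔ : Δ.IsCompactPolygon) (hn : ∀ v, ∃ z, Δ.graph.Adj v z) :
    Tendsto φ U (𝓝 g) := by
  rw [nhds_induced, tendsto_comap_iff, ContinuousMap.tendsto_nhds_compactOpen]
  intro K hK O hO hgK
  by_contra hc
  have hc : ∀ᶠ i in (U : Filter ι), ¬ Set.MapsTo (Δ.toContinuousMap (φ i)) K O :=
    Ultrafilter.eventually_not.2 hc
  -- Only needed for a default point of `K`.
  obtain ⟨i₀, hi₀⟩ := hc.exists
  have hex : ∀ i, ∃ X ∈ K, ¬ Set.MapsTo (Δ.toContinuousMap (φ i)) K O →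
      Δ.chamberMap (φ i).1 X ∉ O := by
    intro i
    by_cases hi : Set.MapsTo (Δ.toContinuousMap (φ i)) K O
    · unfold Set.MapsTo at hi₀
      push Not at hi₀
      obtain ⟨X, hX, -⟩ := hi₀
      exact ⟨X, hX, fun h => absurd hi h⟩
    · have hi' := hi
      unfold Set.MapsTo at hi'
      push Not at hi'
      obtain ⟨X, hX, hXO⟩ := hi'
      exact ⟨X, hX, fun _ => hXO⟩
  choose X hXK hXO using hex
  obtain ⟨C, hC, hXC⟩ := hK.ultrafilter_le_nhds (U.map X)
    (le_principal_iff.2 (Eventually.of_forall hXK : ∀ᶠ i in (U : Filter ι), X i ∈ K))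
  have h1 := h.tendsto_chamberMap hΔ hn (X := X) (C := C) hXC
  obtain ⟨i, h2, h3⟩ := ((h1.eventually (hO.mem_nhds (hgK hC))).and hc).exists
  exact hXO i h3 h2

end TopAut

variable {V : Type*} [TopologicalSpace V] {n : ℕ} {Δ : MGon V (n + 3)} {ι : Type*}

open HomPair

theorem IsCompactPolygon.exists_isom (h : Δ.IsCompactPolygon) (ht : Δ.IsThick) {f : V → V}
    (hf : (Δ.polygon ht).IsHom (Δ.polygon ht) f) (hs : Function.Surjective f)
    (hc : Continuous f) : ∃ g : Δ.topAut, ∀ x, g.1 x = f x := by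
  have hn : ∀ v, ∃ z, Δ.graph.Adj v z := fun v => (ht.exists_adj v v v).imp fun _ h => h.1
  have hi := h.injective ht hf hs hc
  let g : Δ.graph ≃g Δ.graph :=
    { Equiv.ofBijective f ⟨hi, hs⟩ with
      map_rel_iff' := by
        intro a b
        change Δ.graph.Adj (f a) (f b) ↔ _
        constructor
        · intro hab
          obtain ⟨y, hy, e⟩ := hf.exists_lift hs (SimpleGraph.dist_eq_one_iff_adj.2 hab)
          rw [← hi e]
          exact SimpleGraph.dist_eq_one_iff_adj.1 hy
        · intro hab
          exact SimpleGraph.dist_eq_one_iff_adj.1 (hf _ _ (SimpleGraph.dist_eq_one_iff_adj.2 hab)) }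
  exact ⟨⟨g, h.mem_topAut hn (g := g) hc⟩, fun _ => rfl⟩

theorem IsCompactPolygon.exists_germ_lim (h : Δ.IsCompactPolygon) (U : Ultrafilter ι)
    (x : Germ (U : Filter ι) V) : ∃ a, ∀ f : ι → V, (f : Germ (U : Filter ι) V) = x →
      Tendsto f U (𝓝 a) := by
  induction x using Germ.inductionOn with | _ a
  obtain ⟨a₀, ha⟩ := h.exists_tendsto U a
  exact ⟨a₀, fun f hf => ha.congr' (Germ.coe_eq.1 hf.symm)⟩

/-- The limit of a germ of functions into the vertices. -/
noncomputable def IsCompactPolygon.germLim (h : Δ.IsCompactPolygon) (U : Ultrafilter ι)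
    (x : Germ (U : Filter ι) V) : V := (h.exists_germ_lim U x).choose

theorem IsCompactPolygon.tendsto_germLim (h : Δ.IsCompactPolygon) (U : Ultrafilter ι)
    (x : ι → V) : Tendsto x U (𝓝 (h.germLim U x)) :=
  (h.exists_germ_lim U x).choose_spec x rfl

theorem IsCompactPolygon.germLim_eq (h : Δ.IsCompactPolygon) {U : Ultrafilter ι}
    {x : ι → V} {a : V} (hx : Tendsto x U (𝓝 a)) : h.germLim U x = a := by
  have := h.metrizable
  exact tendsto_nhds_unique (h.tendsto_germLim U x) hx

/-- The specialization of the ultrapower, and its composition with a family of automorphisms. -/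
noncomputable def IsCompactPolygon.germPair (h : Δ.IsCompactPolygon) (ht : Δ.IsThick)
    (U : Ultrafilter ι) (φ : ι → Δ.topAut) :
    HomPair ((Δ.polygon ht).ultrapower U) (Δ.polygon ht) where
  σ := h.germLim U
  ψ x := h.germLim U (Germ.map₂ (fun (g : Δ.topAut) v => g.1 v) φ x)
  homσ x y hxy := by
    induction x using Germ.inductionOn with | _ a
    induction y using Germ.inductionOn with | _ b
    rw [ultrapower_d_eq_iff] at hxy
    exact SimpleGraph.dist_eq_one_iff_adj.2 <|
      h.adj_of_tendsto (h.tendsto_germLim U a) (h.tendsto_germLim U b) <|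
        hxy.mono fun i hi => SimpleGraph.dist_eq_one_iff_adj.1 hi
  homψ x y hxy := by
    induction x using Germ.inductionOn with | _ a
    induction y using Germ.inductionOn with | _ b
    rw [ultrapower_d_eq_iff] at hxy
    exact SimpleGraph.dist_eq_one_iff_adj.2 <|
      h.adj_of_tendsto (h.tendsto_germLim U fun i => (φ i).1 (a i))
        (h.tendsto_germLim U fun i => (φ i).1 (b i)) <|
        hxy.mono fun i hi => (φ i).1.map_adj_iff.2 (SimpleGraph.dist_eq_one_iff_adj.1 hi)
  surjσ a := ⟨((fun _ => a : ι → V) : Germ (U : Filter ι) V), h.germLim_eq tendsto_const_nhds⟩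
  surjψ a := by
    refine ⟨((fun i => (φ i).1.symm a : ι → V) : Germ (U : Filter ι) V), ?_⟩
    refine h.germLim_eq (x := fun i => (φ i).1 ((φ i).1.symm a)) ?_
    simp only [RelIso.apply_symm_apply]
    exact tendsto_const_nhds

variable {h : Δ.IsCompactPolygon} {ht : Δ.IsThick} {U : Ultrafilter ι} {φ : ι → Δ.topAut}

theorem germPair_σ {x : ι → V} {a : V} (hx : Tendsto x U (𝓝 a)) :
    (h.germPair ht U φ).σ x = a := h.germLim_eq hx

theorem germPair_ψ {x : ι → V} {a : V} (hx : Tendsto (fun i => (φ i).1 (x i)) U (𝓝 a)) :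
    (h.germPair ht U φ).ψ x = a := h.germLim_eq hx

theorem tendsto_germPair_ψ (x : ι → V) :
    Tendsto (fun i => (φ i).1 (x i)) U (𝓝 ((h.germPair ht U φ).ψ x)) :=
  h.tendsto_germLim U fun i => (φ i).1 (x i)

/-- If `x i` tends to `a`, its germ has σ-value `a`, so `φ i (x i)` tends to `τ a`: factoring is the
same as continuous convergence. -/
theorem exists_convergesTo_of_factor (hfac : ∀ x y, (h.germPair ht U φ).σ x =
    (h.germPair ht U φ).σ y → (h.germPair ht U φ).ψ x = (h.germPair ht U φ).ψ y) :
    ∃ g : Δ.topAut, Δ.ConvergesTo U φ g.1 := by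
  have := h.metrizable
  obtain ⟨τ, hτ, hs, hστ⟩ := exists_factor hfac
  have hconv : Δ.ConvergesTo U φ τ := by
    intro x a hx
    rw [← germPair_σ (h := h) (ht := ht) (φ := φ) hx, hστ]
    exact tendsto_germPair_ψ x
  have hcont : Continuous τ := by
    let := TopologicalSpace.metrizableSpaceMetric V
    exact continuous_of_tendsto_ultrafilter U (φ := fun i => ((φ i).1 : V → V))
      (fun i => (φ i).2.1.continuous) hconv
  obtain ⟨g, hg⟩ := h.exists_isom ht hτ hs hcont
  refine ⟨g, ?_⟩
  rwa [show ((g.1 : Δ.graph ≃g Δ.graph) : V → V) = τ from funext hg]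

theorem exists_convergesTo (hgood : ∀ x, (h.germPair ht U φ).Good x) :
    ∃ g : Δ.topAut, Δ.ConvergesTo U φ g.1 := by
  have := h.metrizable
  obtain ⟨o⟩ := Δ.connected.nonempty
  rcases comparable hgood ((fun _ => o : ι → V) : Germ (U : Filter ι) V) with hc | hc
  · exact exists_convergesTo_of_factor hc
  -- otherwise, the inverses converge
  have hinv : ∀ x y, (h.germPair ht U fun i => (φ i)⁻¹).σ x = (h.germPair ht U fun i => (φ i)⁻¹).σ y →
      (h.germPair ht U fun i => (φ i)⁻¹).ψ x = (h.germPair ht U fun i => (φ i)⁻¹).ψ y := by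
    intro x y hxy
    induction x using Germ.inductionOn with | _ a
    induction y using Germ.inductionOn with | _ b
    -- Reparametrizing germs by the inverses exchanges the roles of σ and ψ.
    have key : ∀ a : ι → V, (h.germPair ht U φ).ψ ((fun i => (φ i).1.symm (a i) : ι → V) :
        Germ (U : Filter ι) V) = (h.germPair ht U fun i => (φ i)⁻¹).σ a := by
      intro a
      refine germPair_ψ ?_
      simp only [RelIso.apply_symm_apply]
      exact h.tendsto_germLim U a
    have h1 := hc ((fun i => (φ i).1.symm (a i) : ι → V) : Germ (U : Filter ι) V)
      ((fun i => (φ i).1.symm (b i) : ι → V) : Germ (U : Filter ι) V) (by rw [key, key, hxy])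
    exact h1
  obtain ⟨g, hg⟩ := exists_convergesTo_of_factor hinv
  refine ⟨g⁻¹, fun x a hx => ?_⟩
  -- Any limit `b` of the images is sent by `g` to `a`, so it is determined.
  obtain ⟨b, hb⟩ := h.exists_tendsto U fun i => (φ i).1 (x i)
  have h1 := hg _ _ hb
  have h2 : (fun i => ((φ i)⁻¹ : Δ.topAut).1 ((φ i).1 (x i))) = x :=
    funext fun i => (φ i).1.symm_apply_apply (x i)
  rw [h2] at h1
  have h3 : a = g.1 b := tendsto_nhds_unique hx h1
  have h4 : (g⁻¹ : Δ.topAut).1 a = b := by rw [h3]; exact g.1.symm_apply_apply b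
  rw [h4]
  exact hb

end MGon

/-! ### Metric conditions and the compactness theorem -/

theorem IsCompatibleMetric.continuous {X : Type*} [t : TopologicalSpace X] {ρ : X → X → ℝ}
    (h : IsCompatibleMetric ρ) : Continuous fun p : X × X => ρ p.1 p.2 := by
  obtain ⟨d, hd, hρ⟩ := h
  subst hd
  simp only [hρ]
  exact continuous_dist

theorem IsCompatibleMetric.self {X : Type*} [TopologicalSpace X] {ρ : X → X → ℝ}
    (h : IsCompatibleMetric ρ) (x : X) : ρ x x = 0 := by
  obtain ⟨d, -, hρ⟩ := h
  rw [hρ, dist_self]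

theorem IsCompatibleMetric.tendsto {X ι : Type*} [TopologicalSpace X] {ρ : X → X → ℝ}
    (h : IsCompatibleMetric ρ) {l : Filter ι} {x y : ι → X} {a b : X} (hx : Tendsto x l (𝓝 a))
    (hy : Tendsto y l (𝓝 b)) : Tendsto (fun i => ρ (x i) (y i)) l (𝓝 (ρ a b)) :=
  (h.continuous.tendsto (a, b)).comp (hx.prodMk_nhds hy)

/-- Sequences whose distance is bounded below do not have the same limit. -/
theorem IsCompatibleMetric.ne_of_tendsto {X ι : Type*} [TopologicalSpace X] {ρ : X → X → ℝ}
    (h : IsCompatibleMetric ρ) {l : Filter ι} [l.NeBot] {x y : ι → X} {a b : X} {ε : ℝ}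
    (hε : 0 < ε) (hx : Tendsto x l (𝓝 a)) (hy : Tendsto y l (𝓝 b))
    (hxy : ∀ᶠ i in l, ε ≤ ρ (x i) (y i)) : a ≠ b := by
  rintro rfl
  have := ge_of_tendsto (h.tendsto hx hy) hxy
  rw [h.self] at this
  exact absurd this (not_le.2 hε)

namespace MGon

theorem Opposite.exists_opp {V : Type*} {n : ℕ} {Δ : MGon V (n + 3)} {C C' : Δ.Chamber}
    (h : Δ.Opposite C C') {x : V} (hx : Δ.IsVertex x C) :
    ∃ w, Δ.IsVertex w C' ∧ Δ.graph.dist x w = n + 3 := by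
  have h1 := h.le_dist hx (.inl rfl)
  have h2 := h.le_dist hx (.inr rfl)
  have h3 := Δ.dist_step x _ _ C'.2.1
  have h4 := Δ.dist_le x C'.1.1
  have h5 := Δ.dist_le x C'.1.2
  by_cases e : Δ.graph.dist x C'.1.1 = n + 3
  · exact ⟨_, .inl rfl, e⟩
  · exact ⟨_, .inr rfl, by omega⟩

variable {V : Type*} [TopologicalSpace V] {n : ℕ} {Δ : MGon V (n + 3)} {ι : Type*}
  {h : Δ.IsCompactPolygon} {ht : Δ.IsThick} {F : Ultrafilter ι} {φ : ι → Δ.topAut}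

theorem tendsto_chamberMap_germPair {x y : ι → V} {x₀ y₀ : V}
    (hxy : ∀ i, Δ.graph.Adj (x i) (y i)) (hx : (h.germPair ht F φ).ψ x = x₀)
    (hy : (h.germPair ht F φ).ψ y = y₀) : ∃ hadj : Δ.graph.Adj x₀ y₀,
      Tendsto (fun i => Δ.chamberMap (φ i).1 (Δ.chamberOf (x i) (y i) (hxy i))) F
        (𝓝 (Δ.chamberOf x₀ y₀ hadj)) := by
  have hn : ∀ v, ∃ z, Δ.graph.Adj v z := fun v => (ht.exists_adj v v v).imp fun _ h => h.1
  have h1 : Tendsto (fun i => (φ i).1 (x i)) F (𝓝 x₀) := hx ▸ tendsto_germPair_ψ x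
  have h2 : Tendsto (fun i => (φ i).1 (y i)) F (𝓝 y₀) := hy ▸ tendsto_germPair_ψ y
  refine ⟨h.adj_of_tendsto h1 h2 (Eventually.of_forall fun i => (φ i).1.map_adj_iff.2 (hxy i)), ?_⟩
  simp only [Δ.chamberMap_chamberOf]
  exact h.tendsto_chamberOf hn _ _ h1 h2

theorem germPair_σ_const (x : V) :
    (h.germPair ht F φ).σ ((fun _ => x : ι → V) : Germ (F : Filter ι) V) = x :=
  germPair_σ tendsto_const_nhds

/-- On constant germs σ is the identity. A germ `z` with σ-value `c` consists of points whose
chambers enter the `ε`-ball around that of `c`, so the ball conditions forbid ψ to glue it to the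
other vertex: this is unmixedness. The conditions on `e` make it the third point. -/
theorem germPair_regular {ρ : Δ.Chamber → Δ.Chamber → ℝ} (hρ : IsCompatibleMetric ρ)
    {ε : ℝ} (hε : 0 < ε) {v y a e : V} (hy : Δ.graph.Adj v y) (ha : Δ.graph.Adj v a)
    (he : Δ.graph.Adj v e) (hya : y ≠ a) (hey : e ≠ y) (hea : e ≠ a)
    (hψ : (h.germPair ht F φ).ψ ((fun _ => y : ι → V) : Germ (F : Filter ι) V) ≠
      (h.germPair ht F φ).ψ ((fun _ => a : ι → V) : Germ (F : Filter ι) V))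
    (h1 : ∀ᶠ i in (F : Filter ι), ∀ X ∈ Δ.panelBall ρ v (Δ.chamberOf v a ha) ε,
      ε ≤ ρ (Δ.chamberMap (φ i).1 (Δ.chamberOf v y hy)) (Δ.chamberMap (φ i).1 X))
    (h2 : ∀ᶠ i in (F : Filter ι), ∀ X ∈ Δ.panelBall ρ v (Δ.chamberOf v y hy) ε,
      ε ≤ ρ (Δ.chamberMap (φ i).1 (Δ.chamberOf v a ha)) (Δ.chamberMap (φ i).1 X))
    (h3 : ∀ᶠ i in (F : Filter ι), ε ≤ ρ (Δ.chamberMap (φ i).1 (Δ.chamberOf v y hy))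
      (Δ.chamberMap (φ i).1 (Δ.chamberOf v e he)))
    (h4 : ∀ᶠ i in (F : Filter ι), ε ≤ ρ (Δ.chamberMap (φ i).1 (Δ.chamberOf v a ha))
      (Δ.chamberMap (φ i).1 (Δ.chamberOf v e he))) :
    (h.germPair ht F φ).Regular ((fun _ => v : ι → V) : Germ (F : Filter ι) V)
      ((fun _ => y : ι → V) : Germ (F : Filter ι) V)
      ((fun _ => a : ι → V) : Germ (F : Filter ι) V) := by
  have hn : ∀ v, ∃ z, Δ.graph.Adj v z := fun v => (ht.exists_adj v v v).imp fun _ h => h.1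
  have key : ∀ (b : V) (hb : Δ.graph.Adj v b) (z : ι → V) (hz : ∀ i, Δ.graph.Adj v (z i)),
      (h.germPair ht F φ).ψ z = (h.germPair ht F φ).ψ
        ((fun _ => b : ι → V) : Germ (F : Filter ι) V) →
      (∀ᶠ i in (F : Filter ι), ε ≤ ρ (Δ.chamberMap (φ i).1 (Δ.chamberOf v b hb))
        (Δ.chamberMap (φ i).1 (Δ.chamberOf v (z i) (hz i)))) → False := by
    intro b hb z hz e hge
    obtain ⟨_, t1⟩ := tendsto_chamberMap_germPair (h := h) (ht := ht) (F := F) (φ := φ)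
      (fun _ => hb) rfl rfl
    obtain ⟨_, t2⟩ := tendsto_chamberMap_germPair (h := h) (ht := ht) (F := F) (φ := φ) hz rfl e
    exact hρ.ne_of_tendsto hε t1 t2 hge rfl
  have mixed : ∀ (b c : V) (hb : Δ.graph.Adj v b) (hc : Δ.graph.Adj v c) (z : ι → V),
      (∀ᶠ i in (F : Filter ι), Δ.graph.Adj v (z i)) →
      (∀ᶠ i in (F : Filter ι), ∀ X ∈ Δ.panelBall ρ v (Δ.chamberOf v c hc) ε,
        ε ≤ ρ (Δ.chamberMap (φ i).1 (Δ.chamberOf v b hb)) (Δ.chamberMap (φ i).1 X)) →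
      (h.germPair ht F φ).σ z = c → (h.germPair ht F φ).ψ z = (h.germPair ht F φ).ψ
        ((fun _ => b : ι → V) : Germ (F : Filter ι) V) → False := by
    classical
    intro b c hb hc z hz hball hσ hψ
    -- Same germ, but adjacent to `v` at every index, so that chambers can be formed.
    let z' : ι → V := fun i => if Δ.graph.Adj v (z i) then z i else b
    have hz' : ∀ i, Δ.graph.Adj v (z' i) := by
      intro i
      by_cases hi : Δ.graph.Adj v (z i)
      · simp [z', hi]
      · simp [z', hi, hb]
    have e : (z : Germ (F : Filter ι) V) = z' := Germ.coe_eq.2 <| hz.mono fun i hi => by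
      simp [z', hi]
    rw [e] at hσ hψ
    have hzc : Tendsto z' F (𝓝 c) := hσ ▸ h.tendsto_germLim F z'
    have hZ := h.tendsto_chamberOf hn hz' hc tendsto_const_nhds hzc
    have hlt : ∀ᶠ i in (F : Filter ι), ρ (Δ.chamberOf v (z' i) (hz' i)) (Δ.chamberOf v c hc) < ε := by
      have := hρ.tendsto hZ (tendsto_const_nhds (x := Δ.chamberOf v c hc))
      rw [hρ.self] at this
      exact this.eventually (gt_mem_nhds hε)
    refine key b hb z' hz' hψ ?_
    filter_upwards [hball, hlt] with i hi hi'
    exact hi _ ⟨(isVertex_chamberOf _).2 (.inl rfl), hi'⟩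
  refine ⟨⟨by simpa only [germPair_σ_const] using hya, hψ⟩,
    ⟨((fun _ => e : ι → V) : Germ (F : Filter ι) V), ?_, ⟨?_, ?_⟩, ⟨?_, ?_⟩⟩, ?_⟩
  · rw [ultrapower_d_const]
    exact SimpleGraph.dist_eq_one_iff_adj.2 he
  · simpa only [germPair_σ_const] using hey
  · exact fun e' => key y hy _ (fun _ => he) e' h3
  · simpa only [germPair_σ_const] using hea
  · exact fun e' => key a ha _ (fun _ => he) e' h4
  · intro z hz
    induction z using Germ.inductionOn with | _ z
    rw [ultrapower_d_eq_iff] at hz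
    have hz' : ∀ᶠ i in (F : Filter ι), Δ.graph.Adj v (z i) :=
      hz.mono fun i hi => SimpleGraph.dist_eq_one_iff_adj.1 hi
    simp only [germPair_σ_const]
    exact ⟨fun e' => mixed a y ha hy z hz' h2 e'.1 e'.2,
      fun e' => mixed y a hy ha z hz' h1 e'.1 e'.2⟩

end MGon

theorem theoremB {V : Type*} [TopologicalSpace V] {m : ℕ} (hm : 3 ≤ m) (Δ : MGon V m)
    (hcompact : Δ.IsCompactPolygon) (hthick : Δ.IsThick)
    (ρ : Δ.Chamber → Δ.Chamber → ℝ) (hρ : IsCompatibleMetric ρ)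
    (C C' : Δ.Chamber) (hCC' : Δ.Opposite C C')
    (A : Δ.graph.Subgraph) (hA : Δ.IsApartment A)
    (hCA : Δ.ChamberIn C A) (hC'A : Δ.ChamberIn C' A)
    (D : Fin 2 → Δ.Chamber) (hDA : ∀ i, Δ.ChamberIn (D i) A) (hDC : ∀ i, D i ≠ C)
    (hD : D 0 ≠ D 1)
    (v : Fin 2 → V) (hvC : ∀ i, Δ.IsVertex (v i) C) (hvD : ∀ i, Δ.IsVertex (v i) (D i))
    (E : Fin 2 → Δ.Chamber) (hvE : ∀ i, Δ.IsVertex (v i) (E i))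
    (hEC : ∀ i, E i ≠ C) (hED : ∀ i, E i ≠ D i)
    (U U' : Set Δ.Chamber) (hU : IsClosed U) (hU' : IsClosed U')
    (hUU' : ∀ X ∈ U, ∀ X' ∈ U', Δ.Opposite X X')
    (ε : ℝ) (hε : 0 < ε) :
    IsCompact {φ : Δ.topAut |
      Δ.chamberMap φ.1 C ∈ U ∧ Δ.chamberMap φ.1 C' ∈ U' ∧
      (∀ i, ∀ X ∈ Δ.panelBall ρ (v i) (D i) ε,
        ε ≤ ρ (Δ.chamberMap φ.1 C) (Δ.chamberMap φ.1 X)) ∧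
      (∀ i, ∀ X ∈ Δ.panelBall ρ (v i) C ε,
        ε ≤ ρ (Δ.chamberMap φ.1 (D i)) (Δ.chamberMap φ.1 X)) ∧
      (∀ i, ε ≤ ρ (Δ.chamberMap φ.1 C) (Δ.chamberMap φ.1 (E i))) ∧
      (∀ i, ε ≤ ρ (Δ.chamberMap φ.1 (D i)) (Δ.chamberMap φ.1 (E i)))} := by
  obtain ⟨n, rfl⟩ : ∃ n, m = n + 3 := ⟨m - 3, by omega⟩
  have hn : ∀ v, ∃ z, Δ.graph.Adj v z := fun v => (hthick.exists_adj v v v).imp fun _ h => h.1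
  have hadj : ∀ {x y : V}, Δ.graph.Adj x y → Δ.graph.dist x y = 1 := fun hxy =>
    SimpleGraph.dist_eq_one_iff_adj.2 hxy
  choose a ha hDa using fun i => MGon.exists_eq_chamberOf (hvD i)
  choose e he hEe using fun i => MGon.exists_eq_chamberOf (hvE i)
  have haA : ∀ i, A.Adj (v i) (a i) := fun i =>
    (MGon.chamberIn_chamberOf (ha i) A).1 (hDa i ▸ hDA i)
  -- In a cycle, a vertex of `C` lies on only one other chamber, whereas `D 0` and `D 1` differ.
  have hv : v 0 ≠ v 1 := by
    intro hv
    obtain ⟨y, hy, hCy⟩ := MGon.exists_eq_chamberOf (hvC 0)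
    have hyA : A.Adj (v 0) y := (MGon.chamberIn_chamberOf hy A).1 (hCy ▸ hCA)
    have hne : ∀ (i : Fin 2), v i = v 0 → a i ≠ y := by
      intro i hi hay
      refine hDC i ?_
      rw [hDa i, hCy]
      simp only [hi, hay]
    have h01 := hA.eq_of_adj hyA (haA 0) (hv ▸ haA 1) (hne 0 rfl) (hne 1 hv.symm)
    refine hD ?_
    rw [hDa 0, hDa 1]
    simp only [hv, h01]
  -- the other vertex of `C`
  have hother : ∀ i : Fin 2, ∃ y, ∃ hy : Δ.graph.Adj (v i) y, C = Δ.chamberOf (v i) y hy ∧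
      y = v (1 - i) := by
    intro i
    have hne : v i ≠ v (1 - i) := by
      fin_cases i
      · exact hv
      · exact hv.symm
    obtain ⟨hy, hC⟩ := MGon.eq_chamberOf (hvC i) (hvC (1 - i)) hne
    exact ⟨_, hy, hC, rfl⟩
  choose y hy hCy hyv using hother
  have hy0 : y 0 = v 1 := hyv 0
  have hy1 : y 1 = v 0 := hyv 1
  have hyA : ∀ i, A.Adj (v i) (y i) := fun i =>
    (MGon.chamberIn_chamberOf (hy i) A).1 (hCy i ▸ hCA)
  have hay : ∀ i, a i ≠ y i := by
    intro i hi
    refine hDC i ?_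
    rw [hDa i, hCy i]
    simp only [hi]
  have hey : ∀ i, e i ≠ y i := by
    intro i hi
    refine hEC i ?_
    rw [hEe i, hCy i]
    simp only [hi]
  have hea : ∀ i, e i ≠ a i := by
    intro i hi
    refine hED i ?_
    rw [hEe i, hDa i]
    simp only [hi]
  choose w hwC' hvw using fun i => hCC'.exists_opp (hvC i)
  have hv01 : Δ.graph.Adj (v 0) (v 1) := hy0 ▸ hy 0
  have hw01 : w 0 ≠ w 1 := by
    intro hw
    have h1 := Δ.dist_step (w 0) _ _ hv01
    have h2 := hvw 0
    have h3 := hvw 1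
    rw [← hw] at h3
    rw [SimpleGraph.dist_comm] at h2 h3
    omega
  obtain ⟨hw, hC'w⟩ := MGon.eq_chamberOf (hwC' 0) (hwC' 1) hw01
  have hwA : A.Adj (w 0) (w 1) := (MGon.chamberIn_chamberOf hw A).1 (hC'w ▸ hC'A)
  have hd0 : Δ.graph.dist (a 0) (w 1) = n + 1 :=
    hA.dist_eq (hyA 0) (haA 0) (hay 0) (A.edge_vert hwA.symm) (hy0 ▸ hvw 1)
  have hd1 : Δ.graph.dist (a 1) (w 0) = n + 1 :=
    hA.dist_eq (hyA 1) (haA 1) (hay 1) (A.edge_vert hwA) (hy1 ▸ hvw 0)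
  rw [isCompact_iff_ultrafilter_le_nhds]
  intro F hF
  have hJ := le_principal_iff.1 hF
  let T := hcompact.germPair hthick F (fun φ : Δ.topAut => φ)
  let c : V → Germ (F : Filter Δ.topAut) V := fun x => ((fun _ => x : Δ.topAut → V) : Germ _ V)
  have hσ : ∀ x, T.σ (c x) = x := fun x => MGon.germPair_σ_const x
  have hc : ∀ x z, ((Δ.polygon hthick).ultrapower F).d (c x) (c z) = Δ.graph.dist x z :=
    fun x z => ultrapower_d_const _ _ x z
  -- The images of `C` and `C'` converge to chambers of the closed sets `U` and `U'`, which are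
  -- opposite. Distances of their vertices are thus at least `n + 2`, and parity does the rest.
  have hopp : ∀ i, T.N (c (v i)) (c (w i)) (n + 3) := by
    intro i
    obtain ⟨h1, t1⟩ := MGon.tendsto_chamberMap_germPair (h := hcompact) (ht := hthick) (F := F)
      (φ := fun φ : Δ.topAut => φ) (fun _ => hv01) rfl rfl
    obtain ⟨h2, t2⟩ := MGon.tendsto_chamberMap_germPair (h := hcompact) (ht := hthick) (F := F)
      (φ := fun φ : Δ.topAut => φ) (fun _ => hw) rfl rfl
    have hC : C = Δ.chamberOf (v 0) (v 1) hv01 := by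
      rw [hCy 0]
      simp only [hy0]
    have m1 := hU.mem_of_tendsto t1 (by filter_upwards [hJ] with φ hφ; exact hC ▸ hφ.1)
    have m2 := hU'.mem_of_tendsto t2 (by filter_upwards [hJ] with φ hφ; exact hC'w ▸ hφ.2.1)
    have hle := (hUU' _ m1 _ m2).le_dist (x := T.ψ (c (v i))) (y := T.ψ (c (w i)))
      ((MGon.isVertex_chamberOf _).2 (by
        fin_cases i
        · exact .inl rfl
        · exact .inr rfl))
      ((MGon.isVertex_chamberOf _).2 (by
        fin_cases i
        · exact .inl rfl
        · exact .inr rfl))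
    refine HomPair.N_of_ge ?_ ?_ ((hc _ _).trans (hvw i))
    · rw [hσ, hσ]
      exact (Nat.le_succ _).trans (hvw i).ge
    · exact Nat.le_of_succ_le_succ hle
  -- Gluing `y i` to `a i` would put `ψ (a i)` opposite `ψ (w j)`, although homomorphisms do not
  -- increase the distance `n + 1`.
  have hψ : ∀ i j, T.N (c (v j)) (c (w j)) (n + 3) → y i = v j → Δ.graph.dist (a i) (w j) = n + 1 →
      T.ψ (c (y i)) ≠ T.ψ (c (a i)) := by
    intro i j hN hyj haw heq
    obtain ⟨k, hk⟩ := T.homψ.d_le (c (a i)) (c (w j))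
    rw [← heq, hyj, hN.2.2, hc, haw] at hk
    omega
  have hreg : ∀ i, T.ψ (c (y i)) ≠ T.ψ (c (a i)) → T.Regular (c (v i)) (c (y i)) (c (a i)) := by
    intro i hi
    refine MGon.germPair_regular hρ hε (hy i) (ha i) (he i) (hay i).symm (hey i) (hea i) hi
      ?_ ?_ ?_ ?_
    · filter_upwards [hJ] with φ hφ
      rw [← hCy i, ← hDa i]
      exact hφ.2.2.1 i
    · filter_upwards [hJ] with φ hφ
      rw [← hCy i, ← hDa i]
      exact hφ.2.2.2.1 i
    · filter_upwards [hJ] with φ hφ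
      rw [← hCy i, ← hEe i]
      exact hφ.2.2.2.2.1 i
    · filter_upwards [hJ] with φ hφ
      rw [← hDa i, ← hEe i]
      exact hφ.2.2.2.2.2 i
  have hr0 := hreg 0 (hψ 0 1 (hopp 1) hy0 hd0)
  have hr1 := hreg 1 (hψ 1 0 (hopp 0) hy1 hd1)
  rw [hy0] at hr0
  rw [hy1] at hr1
  have hgood : ∀ x, T.Good x := HomPair.Good.all (HomPair.Frame.good
    ⟨(hc _ _).trans (hadj hv01), (hc _ _).trans (hadj hw), hopp 0, hopp 1,
      (hc _ _).trans (hadj (ha 0)), (hc _ _).trans (hadj (ha 1)), (hc _ _).trans hd0,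
      (hc _ _).trans hd1, hr0, hr1⟩)
  obtain ⟨g, hg⟩ := MGon.exists_convergesTo hgood
  have hlim : ∀ X : Δ.Chamber, Tendsto (fun φ : Δ.topAut => Δ.chamberMap φ.1 X) F
      (𝓝 (Δ.chamberMap g.1 X)) := fun X => hg.tendsto_chamberMap hcompact hn tendsto_const_nhds
  refine ⟨g, ⟨?_, ?_, fun i X hX => ?_, fun i X hX => ?_, fun i => ?_, fun i => ?_⟩,
    hg.tendsto hcompact hn⟩
  · exact hU.mem_of_tendsto (hlim C) (by filter_upwards [hJ] with φ hφ; exact hφ.1)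
  · exact hU'.mem_of_tendsto (hlim C') (by filter_upwards [hJ] with φ hφ; exact hφ.2.1)
  · exact ge_of_tendsto (hρ.tendsto (hlim _) (hlim _))
      (by filter_upwards [hJ] with φ hφ; exact hφ.2.2.1 i X hX)
  · exact ge_of_tendsto (hρ.tendsto (hlim _) (hlim _))
      (by filter_upwards [hJ] with φ hφ; exact hφ.2.2.2.1 i X hX)
  · exact ge_of_tendsto (hρ.tendsto (hlim _) (hlim _))
      (by filter_upwards [hJ] with φ hφ; exact hφ.2.2.2.2.1 i)
  · exact ge_of_tendsto (hρ.tendsto (hlim _) (hlim _))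
      (by filter_upwards [hJ] with φ hφ; exact hφ.2.2.2.2.2 i)
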